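/- Let $p_1,p_2,m$ be natural numbers, $I_1=\{1,\dots,p_1\}$, $I_2=\{1,\dots,p_2\}$, $I_u=\{1,\dots,m\}$, $\mathbb N=\{1,2,\dots\}$. Let $P$ and $R$ be symmetric infinite matrices indexed by $\mathbb N\times\mathbb N$ with $\sum_{s,t}[P]_{s,t}^2<\infty$, strictly positive definite (every finite section is positive definite) and with $[P]_{t,t}\le\kappa t^{\alpha}e^{-\beta t}$ for some $\kappa,\beta>0$, $\alpha\in\mathbb R$ and all $t\in\mathbb N$; likewise for $R$ (with its own constants). Consider real random sequences $g^{[hk,jl]}$ and $f^{[hk,i]}$ on $\mathbb N$ ($h,j\in I_1$, $k,l\in I_2$, $i\in I_u$); let $\theta_g$ and $\theta_f$ be the processes that collect all the $g^{[hk,jl]}$ and all the $f^{[hk,i]}$, respectively, and let $\theta=[\theta_g^\top\ \theta_f^\top]^\top$. **Maximum entropy problem.** For finite sets $\mathcal I_g,\mathcal I_f\subset\mathbb N$ let $\check\theta$ be the vector of all entries of the $g^{[hk,jl]}$ with time in $\mathcal I_g$ and of the $f^{[hk,i]}$ with time in $\mathcal I_f$, with sub-vectors $\check g^{[hk,jl]}$,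 $\check f^{[hk,i]}$, and let $P_{\mathcal I_g}$, $R_{\mathcal I_f}$ be the corresponding sections of $P$, $R$. Write $\|v\|^2_{A^{-1}}=v^\top A^{-1}v$. Given constants $C=(C'_{hj},C''_{kl},D'_h,D''_{ki})$, the problem $\mathrm{ME}_{\mathcal I}(C)$ is to maximize the differential entropy $-\int \mathbf p\log\mathbf p$ over all bounded, everywhere positive probability densities $\mathbf p$ of $\check\theta$ such that $$\sum_{k,l}\mathbb E\|\check g^{[hk,jl]}\|^2_{P_{\mathcal I_g}^{-1}}\le C'_{hj}\ \ \forall h,j,\qquad \sum_{h,j}\mathbb E\|\check g^{[hk,jl]}\|^2_{P_{\mathcal I_g}^{-1}}\le C''_{kl}\ \ \forall k,l,$$ $$\sum_{k,i}\mathbb E\|\check f^{[hk,i]}\|^2_{R_{\mathcal I_f}^{-1}}\le D'_{h}\ \ \forall h,\qquad \sum_{h}\mathbb E\|\check f^{[hk,i]}\|^2_{R_{\mathcal I_f}^{-1}}\le D''_{ki}\ \ \forall k,i .$$ For $C\ge0$, a probability law $\nu$ is called the *extended maximum entropy solution* of $\mathrm{ME}_{\mathcal I}(C)$ if for all strictly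 positive constants $\tilde C$ the problem $\mathrm{ME}_{\mathcal I}(\tilde C)$ has a solution, unique up to null sets, and the law defined by this solution converges weakly to $\nu$ as $\tilde C\to C$ through strictly positive constants. (If $C$ itself is strictly positive, then $\nu$ is the law whose density solves $\mathrm{ME}_{\mathcal I}(C)$.) **Kernels.** For nonnegative hyperparameters $\xi=(\lambda_{hj},\gamma_{kl},\pi_h,\omega_{ki})$ let $\Lambda,\Gamma,\Pi,\Omega$ be the diagonal matrices with these entries, and let $$X_g=(\Lambda\otimes\Gamma)(\Lambda\otimes I+I\otimes\Gamma)^{-1},\qquad X_f=(\Pi\otimes\Omega)(\Pi\otimes I+I\otimes\Omega)^{-1},$$ i.e. the diagonal matrices with entries $\frac{\lambda_{hj}\gamma_{kl}}{\lambda_{hj}+\gamma_{kl}}$ and $\frac{\pi_h\omega_{ki}}{\pi_h+\omega_{ki}}$, read as $0$ when both parameters vanish. **Statement.** Let "non-null" mean that each of the four families has at least one positive entry. 1. For all non-null nonnegative hyperparameters $\xi$ there exists a zero-mean Gaussian process $\theta=[\theta_g^\top\ \theta_f^\top]^\top$, with $\theta_g$ and $\theta_f$ uncorrelated (hence independent)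 and with kernels $K_g=X_g\otimes P$ and $K_f=X_f\otimes R$, and there are nonnegative constants $c=(c'_{hj},c''_{kl},d'_h,d''_{ki})$, each of them positive exactly when the hyperparameter with the same index ($\lambda_{hj},\gamma_{kl},\pi_h,\omega_{ki}$, respectively) is positive, such that for all finite $\mathcal I_g,\mathcal I_f\subset\mathbb N$ the law of $\check\theta$ is the extended maximum entropy solution of $\mathrm{ME}_{\mathcal I}(C)$ with $C=(|\mathcal I_g|c'_{hj},|\mathcal I_g|c''_{kl},|\mathcal I_f|d'_h,|\mathcal I_f|d''_{ki})$. 2. Conversely, for all non-null nonnegative constants $c=(c'_{hj},c''_{kl},d'_h,d''_{ki})$ there are nonnegative hyperparameters $\xi$, each of them positive exactly when the constant with the same index is positive, and a zero-mean Gaussian process $\theta$ with $\theta_g,\theta_f$ uncorrelated and with kernels $K_g=X_g\otimes P$, $K_f=X_f\otimes R$, such that for all finite $\mathcal I_g,\mathcal I_f\subset\mathbb N$ the law of $\check\theta$ is the extended maximum entropy solution of $\mathrm{ME}_{\mathcal I}(C)$ with the same $C$ as in 1. -/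

import Mathlib

open MeasureTheory ProbabilityTheory Filter Topology
open scoped ENNReal Kronecker

namespace KroneckerMaxEnt

/-! ### Index sets

The impulse responses are `g^{[hk,jl]}`, labelled by `((h, j), (k, l))`, and `f^{[hk,i]}`, labelled
by `(h, (k, i))`; time runs through the positive integers. -/

/-- Labels `((h, j), (k, l))` of the impulse responses `g^{[hk,jl]}`. -/
abbrev GBlock (p₁ p₂ : ℕ) : Type := (Fin p₁ × Fin p₁) × (Fin p₂ × Fin p₂)

/-- Labels `(h, (k, i))` of the impulse responses `f^{[hk,i]}`. -/
abbrev FBlock (p₁ p₂ m : ℕ) : Type := Fin p₁ × (Fin p₂ × Fin m)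

/-- Index set of the process `θ = [θ_gᵀ θ_fᵀ]ᵀ`. -/
abbrev PathIdx (p₁ p₂ m : ℕ) : Type := (GBlock p₁ p₂ × ℕ+) ⊕ (FBlock p₁ p₂ m × ℕ+)

/-- Index set of the finite vector extracted from `θ` by taking the times in `Ig` for every
component of `θ_g` and the times in `If` for every component of `θ_f`. -/
abbrev FinIdx (p₁ p₂ m : ℕ) (Ig If : Finset ℕ+) : Type :=
  (GBlock p₁ p₂ × ↥Ig) ⊕ (FBlock p₁ p₂ m × ↥If)

/-- The inclusion of the finite index set into the index set of the process. -/
def FinIdx.incl {p₁ p₂ m : ℕ} {Ig If : Finset ℕ+} : FinIdx p₁ p₂ m Ig If → PathIdx p₁ p₂ m :=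
  Sum.map (Prod.map id Subtype.val) (Prod.map id Subtype.val)

/-- One label for each scalar moment constraint; the same labels number the hyperparameters:
`gOuter h j` carries `c'_{hj}` and `λ_{hj}`, `gInner k l` carries `c''_{kl}` and `γ_{kl}`,
`fOuter h` carries `d'_h` and `π_h`, `fInner k i` carries `d''_{ki}` and `ω_{ki}`. -/
inductive Label (p₁ p₂ m : ℕ) : Type
  | gOuter (h j : Fin p₁)
  | gInner (k l : Fin p₂)
  | fOuter (h : Fin p₁)
  | fInner (k : Fin p₂) (i : Fin m)

/-- In each of the four families at least one entry is positive. -/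
def NonNull {p₁ p₂ m : ℕ} (c : Label p₁ p₂ m → ℝ) : Prop :=
  (∃ h j, 0 < c (.gOuter h j)) ∧ (∃ k l, 0 < c (.gInner k l)) ∧
  (∃ h, 0 < c (.fOuter h)) ∧ (∃ k i, 0 < c (.fInner k i))

/-! ### Kernels -/

/-- The standing assumption on the kernels `P` and `R`: an element of `S₂(ℕ)`, strictly positive
definite (every finite section is positive definite), with exponentially decaying diagonal. -/
structure IsAdmissibleKernel (P : Matrix ℕ+ ℕ+ ℝ) : Prop where
  isSymm : P.IsSymm
  hilbertSchmidt : Summable fun ij : ℕ+ × ℕ+ => P ij.1 ij.2 ^ 2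
  posDef : P.PosDef
  decay : ∃ κ β α : ℝ, 0 < κ ∧ 0 < β ∧
    ∀ t : ℕ+, P t t ≤ κ * (t : ℝ) ^ α * Real.exp (-β * (t : ℝ))

/-- The kernel matrix with entries extracted from `P` according to `I`. -/
def kernelMatrix (P : Matrix ℕ+ ℕ+ ℝ) (I : Finset ℕ+) : Matrix ↥I ↥I ℝ :=
  P.submatrix Subtype.val Subtype.val

/-- The diagonal matrix `(A ⊗ B)(A ⊗ I + I ⊗ B)⁻¹` of two nonnegative diagonal matrices
`A = diag a`, `B = diag b`, with the convention `0 * 0 / (0 + 0) = 0` (which Lean's division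
satisfies) when two entries vanish. -/
noncomputable def gainMatrix {α β : Type*} [DecidableEq α] [DecidableEq β]
    (a : α → ℝ) (b : β → ℝ) : Matrix (α × β) (α × β) ℝ :=
  Matrix.diagonal fun s => a s.1 * b s.2 / (a s.1 + b s.2)

/-- For positive entries `gainMatrix` is literally `(A ⊗ B)(A ⊗ I + I ⊗ B)⁻¹`. -/
theorem gainMatrix_eq {α β : Type*} [DecidableEq α] [DecidableEq β] [Fintype α] [Fintype β]
    (a : α → ℝ) (b : β → ℝ) (ha : ∀ i, 0 < a i) (hb : ∀ j, 0 < b j) :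
    gainMatrix a b = (Matrix.diagonal a ⊗ₖ Matrix.diagonal b) *
      (Matrix.diagonal a ⊗ₖ (1 : Matrix β β ℝ) + (1 : Matrix α α ℝ) ⊗ₖ Matrix.diagonal b)⁻¹ := by
  have hne : ∀ s : α × β, a s.1 + b s.2 ≠ 0 := fun s => (add_pos (ha _) (hb _)).ne'
  have h1 : (Matrix.diagonal a ⊗ₖ (1 : Matrix β β ℝ) + (1 : Matrix α α ℝ) ⊗ₖ Matrix.diagonal b)
      = Matrix.diagonal fun s : α × β => a s.1 + b s.2 := by
    rw [← Matrix.diagonal_one, ← Matrix.diagonal_one, Matrix.diagonal_kronecker_diagonal,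
      Matrix.diagonal_kronecker_diagonal, Matrix.diagonal_add]
    simp
  have h2 : (Matrix.diagonal fun s : α × β => a s.1 + b s.2)⁻¹
      = Matrix.diagonal fun s : α × β => (a s.1 + b s.2)⁻¹ := by
    apply Matrix.inv_eq_right_inv
    rw [Matrix.diagonal_mul_diagonal, ← Matrix.diagonal_one]
    congr 1
    funext s
    exact mul_inv_cancel₀ (hne s)
  rw [h1, h2, Matrix.diagonal_kronecker_diagonal, Matrix.diagonal_mul_diagonal]
  rfl

/-- `X_g`, built from `Λ = diag(λ_{hj})` and `Γ = diag(γ_{kl})`. -/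
noncomputable def Xg {p₁ p₂ m : ℕ} (ξ : Label p₁ p₂ m → ℝ) :
    Matrix (GBlock p₁ p₂) (GBlock p₁ p₂) ℝ :=
  gainMatrix (fun hj : Fin p₁ × Fin p₁ => ξ (.gOuter hj.1 hj.2))
    (fun kl : Fin p₂ × Fin p₂ => ξ (.gInner kl.1 kl.2))

/-- `X_f`, built from `Π = diag(π_h)` and `Ω = diag(ω_{ki})`. -/
noncomputable def Xf {p₁ p₂ m : ℕ} (ξ : Label p₁ p₂ m → ℝ) :
    Matrix (FBlock p₁ p₂ m) (FBlock p₁ p₂ m) ℝ :=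
  gainMatrix (fun h : Fin p₁ => ξ (.fOuter h))
    (fun ki : Fin p₂ × Fin m => ξ (.fInner ki.1 ki.2))

/-- The kernel of `θ`: `K_g = X_g ⊗ P` for `θ_g`, `K_f = X_f ⊗ R` for `θ_f`, no correlation
between `θ_g` and `θ_f`. -/
noncomputable def jointKernel {p₁ p₂ m : ℕ} (P R : Matrix ℕ+ ℕ+ ℝ) (ξ : Label p₁ p₂ m → ℝ) :
    Matrix (PathIdx p₁ p₂ m) (PathIdx p₁ p₂ m) ℝ :=
  Matrix.fromBlocks (Xg ξ ⊗ₖ P) 0 0 (Xf ξ ⊗ₖ R)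

/-- `μ` is the law of a zero-mean Gaussian process with covariance function `K`. -/
structure IsZeroMeanGaussianLaw {T : Type*} (K : Matrix T T ℝ)
    (μ : ProbabilityMeasure (T → ℝ)) : Prop where
  gaussian : IsGaussianProcess (fun (t : T) (θ : T → ℝ) => θ t) (μ : Measure (T → ℝ))
  mean_zero : ∀ t, ∫ θ, θ t ∂(μ : Measure (T → ℝ)) = 0
  cov_eq : ∀ s t, cov[fun θ => θ s, fun θ => θ t; (μ : Measure (T → ℝ))] = K s t

/-- The law of the finite vector extracted from the process. -/
noncomputable def marginal {p₁ p₂ m : ℕ} (μ : ProbabilityMeasure (PathIdx p₁ p₂ m → ℝ))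
    (Ig If : Finset ℕ+) : ProbabilityMeasure (FinIdx p₁ p₂ m Ig If → ℝ) :=
  μ.map (f := fun θ i => θ (FinIdx.incl i))
    (measurable_pi_lambda _ fun _ => measurable_pi_apply _).aemeasurable

/-! ### The maximum entropy problem -/

/-- The class of probability densities on `ℝ^ι` that are bounded and take positive values. -/
structure IsPosBddDensity {ι : Type*} [Fintype ι] (p : (ι → ℝ) → ℝ) : Prop where
  measurable : Measurable p
  pos : ∀ x, 0 < p x
  bounded : ∃ M : ℝ, ∀ x, p x ≤ M
  lintegral_eq_one : ∫⁻ x, ENNReal.ofReal (p x) = 1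

/-- The probability measure `p(x) dx`. -/
noncomputable def densityLaw {ι : Type*} [Fintype ι] (p : (ι → ℝ) → ℝ) : Measure (ι → ℝ) :=
  volume.withDensity fun x => ENNReal.ofReal (p x)

/-- Differential entropy `-∫ p log p`, in the extended reals, as the integral of the positive part
minus the integral of the negative part (the latter is finite for a bounded density). -/
noncomputable def entropy {ι : Type*} [Fintype ι] (p : (ι → ℝ) → ℝ) : EReal :=
  ((∫⁻ x, ENNReal.ofReal (Real.negMulLog (p x)) : ℝ≥0∞) : EReal) -
    ((∫⁻ x, ENNReal.ofReal (-Real.negMulLog (p x)) : ℝ≥0∞) : EReal)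

/-- `‖v‖²_{P_I⁻¹} = vᵀ P_I⁻¹ v`. -/
noncomputable def sqNorm (P : Matrix ℕ+ ℕ+ ℝ) (I : Finset ℕ+) (v : ↥I → ℝ) : ℝ :=
  v ⬝ᵥ ((kernelMatrix P I)⁻¹.mulVec v)

/-- `E ‖g^{[hk,jl]}‖²` in the norm of `P_{Ig}⁻¹` when the extracted vector has density `p`. -/
noncomputable def gEnergy {p₁ p₂ m : ℕ} (P : Matrix ℕ+ ℕ+ ℝ) (Ig If : Finset ℕ+)
    (p : (FinIdx p₁ p₂ m Ig If → ℝ) → ℝ) (s : GBlock p₁ p₂) : ℝ≥0∞ :=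
  ∫⁻ x, ENNReal.ofReal (sqNorm P Ig fun t => x (.inl (s, t))) ∂(densityLaw p)

/-- `E ‖f^{[hk,i]}‖²` in the norm of `R_{If}⁻¹` when the extracted vector has density `p`. -/
noncomputable def fEnergy {p₁ p₂ m : ℕ} (R : Matrix ℕ+ ℕ+ ℝ) (Ig If : Finset ℕ+)
    (p : (FinIdx p₁ p₂ m Ig If → ℝ) → ℝ) (s : FBlock p₁ p₂ m) : ℝ≥0∞ :=
  ∫⁻ x, ENNReal.ofReal (sqNorm R If fun t => x (.inr (s, t))) ∂(densityLaw p)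

/-- The left-hand sides of the four families of moment constraints. -/
noncomputable def moment {p₁ p₂ m : ℕ} (P R : Matrix ℕ+ ℕ+ ℝ) (Ig If : Finset ℕ+)
    (p : (FinIdx p₁ p₂ m Ig If → ℝ) → ℝ) : Label p₁ p₂ m → ℝ≥0∞
  | .gOuter h j => ∑ k, ∑ l, gEnergy P Ig If p ((h, j), (k, l))
  | .gInner k l => ∑ h, ∑ j, gEnergy P Ig If p ((h, j), (k, l))
  | .fOuter h => ∑ k, ∑ i, fEnergy R Ig If p (h, (k, i))
  | .fInner k i => ∑ h, fEnergy R Ig If p (h, (k, i))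

/-- `p` is admissible for the maximum entropy problem with constants `c`. -/
structure IsFeasible {p₁ p₂ m : ℕ} (P R : Matrix ℕ+ ℕ+ ℝ) (Ig If : Finset ℕ+)
    (c : Label p₁ p₂ m → ℝ) (p : (FinIdx p₁ p₂ m Ig If → ℝ) → ℝ) : Prop where
  density : IsPosBddDensity p
  constraints : ∀ a, moment P R Ig If p a ≤ ENNReal.ofReal (c a)

/-- `ν` is the law given by an optimal density of the maximum entropy problem with constants `c`. -/
def IsMaxEntLaw {p₁ p₂ m : ℕ} (P R : Matrix ℕ+ ℕ+ ℝ) (Ig If : Finset ℕ+)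
    (c : Label p₁ p₂ m → ℝ) (ν : ProbabilityMeasure (FinIdx p₁ p₂ m Ig If → ℝ)) : Prop :=
  ∃ p, IsFeasible P R Ig If c p ∧
    (∀ q, IsFeasible P R Ig If c q → entropy q ≤ entropy p) ∧
    (ν : Measure (FinIdx p₁ p₂ m Ig If → ℝ)) = densityLaw p

/-- The maximum entropy solution extended by continuity to constants `c ≥ 0`: for all strictly
positive constants the problem has a solution `F c'`, unique as a law, and `F c'` converges weakly
to `ν` as the positive constants `c'` tend to `c`. (If `c` is itself strictly positive, this
forces `ν = F c`.) -/
def IsExtendedMaxEntLaw {p₁ p₂ m : ℕ} (P R : Matrix ℕ+ ℕ+ ℝ) (Ig If : Finset ℕ+)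
    (c : Label p₁ p₂ m → ℝ) (ν : ProbabilityMeasure (FinIdx p₁ p₂ m Ig If → ℝ)) : Prop :=
  ∃ F : (Label p₁ p₂ m → ℝ) → ProbabilityMeasure (FinIdx p₁ p₂ m Ig If → ℝ),
    (∀ c', (∀ a, 0 < c' a) → ∀ ν', IsMaxEntLaw P R Ig If c' ν' ↔ ν' = F c') ∧
    Tendsto F (𝓝[{c' | ∀ a, 0 < c' a}] c) (𝓝 ν)

/-- Constants for the index sets `Ig`, `If` out of constants per time sample: the bounds on `g` are
multiplied by `|Ig|`, those on `f` by `|If|`. -/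
def scaledConstants {p₁ p₂ m : ℕ} (Ig If : Finset ℕ+) (c : Label p₁ p₂ m → ℝ) :
    Label p₁ p₂ m → ℝ
  | .gOuter h j => (Ig.card : ℝ) * c (.gOuter h j)
  | .gInner k l => (Ig.card : ℝ) * c (.gInner k l)
  | .fOuter h => (If.card : ℝ) * c (.fOuter h)
  | .fInner k i => (If.card : ℝ) * c (.fInner k i)

/-- All finite-dimensional laws of `μ` are the extended maximum entropy solutions, with the
constants `c` per time sample. -/
def IsMaxEntProcess {p₁ p₂ m : ℕ} (P R : Matrix ℕ+ ℕ+ ℝ) (c : Label p₁ p₂ m → ℝ)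
    (μ : ProbabilityMeasure (PathIdx p₁ p₂ m → ℝ)) : Prop :=
  ∀ Ig If : Finset ℕ+,
    IsExtendedMaxEntLaw P R Ig If (scaledConstants Ig If c) (marginal μ Ig If)

end KroneckerMaxEnt

namespace KroneckerMaxEnt

/-! ### Balanced gains: the finite-dimensional convex program -/

/-! The constraints see a density only through the block energies, so the problem hides a finite
convex program. Among laws with block energies `|I| X s` the Gaussian one with independent blocks of
covariance `X s • P_I` has the largest entropy, which is a constant plus `|I| / 2 * ∑ log (X s)`. It
remains to maximize `∑ log (X (a, b))` under bounds on row and column sums, separately for `g` and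
`f`. The optimality conditions say `X (a, b) = (μ a + ν b)⁻¹` with nonnegative multipliers, and this
is `λ γ / (λ + γ)` for `λ = μ⁻¹`, `γ = ν⁻¹`, once the multipliers are shifted to be positive.
`IsBalanced` records these conditions; `exists_balanced_weights` finds the multipliers by maximizing
the dual product `∏ (μ a + ν b)` over a simplex.

Optimality among all densities comes from Gibbs' inequality against `exp (-κ - Q / 2)`, where `Q`
weights the block energies by `(X s)⁻¹`. The multipliers bound `E Q` by the dimension of the vector
for every feasible density, and the Gaussian attains this value; the equality case gives uniqueness
(`entropy_le_of_lintegral_le`, `isMaxEntLaw_iff`).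

Zero constants are reached by continuity. In `IsBalanced.tendsto` two balanced gains are tested
against each other's multipliers, which forces `∑ (X' / X + X / X' - 2)` to zero. All the Gaussian
laws are images of one unit-gain process under multiplication by `√X`, so convergence of gains gives
weak convergence (`tendsto_marginal_scaleLaw`).

A block with covariance `X s • P_I` has energy `|I| X s`, so after division by `|I|` the program is
the same for all nonempty time sets and one process serves them all. Both directions of the theorem
then concern gains only: row and column sums of `λ γ / (λ + γ)` serve as constants, and conversely
shifted multipliers give hyperparameters. -/

theorem one_add_sum_le_prod_one_add {ι : Type*} (s : Finset ι) (x : ι → ℝ)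
    (hx : ∀ i ∈ s, 0 ≤ x i) : 1 + ∑ i ∈ s, x i ≤ ∏ i ∈ s, (1 + x i) := by
  classical
  induction s using Finset.induction_on with
  | empty => simp
  | insert a s ha ih =>
    rw [Finset.sum_insert ha, Finset.prod_insert ha]
    have h1 := ih fun i hi => hx i (Finset.mem_insert_of_mem hi)
    have h2 := hx a (Finset.mem_insert_self a s)
    have h3 : 0 ≤ ∑ i ∈ s, x i :=
      Finset.sum_nonneg fun i hi => hx i (Finset.mem_insert_of_mem hi)
    nlinarith

/-- Both sides equal `1` at `τ = 0`, so their slopes there compare. This replaces differentiating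
the objective at a maximizer. -/
theorem le_of_one_add_mul_le_exp {A r : ℝ} (hr : 0 ≤ r)
    (h : ∀ τ : ℝ, 0 < τ → 1 + τ * A ≤ Real.exp (τ * r)) : A ≤ r := by
  by_contra! hA
  have hr1 : 0 < r ^ 2 + 1 := by positivity
  -- The first bound gives `τ * r ≤ 1`, so that `exp` is within `(τ * r) ^ 2` of its linear part;
  -- the second keeps the resulting error `τ * r ^ 2` below half of the gap `A - r`.
  set τ := min (1 / (r + 1)) ((A - r) / (2 * (r ^ 2 + 1))) with hτ
  have hτ0 : 0 < τ := lt_min (by positivity) (div_pos (by linarith) (by positivity))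
  have h1 : τ * (r + 1) ≤ 1 := by
    have := min_le_left (1 / (r + 1)) ((A - r) / (2 * (r ^ 2 + 1)))
    rw [← hτ, le_div_iff₀ (by positivity)] at this
    exact this
  have h2 : τ * (2 * (r ^ 2 + 1)) ≤ A - r := by
    have := min_le_right (1 / (r + 1)) ((A - r) / (2 * (r ^ 2 + 1)))
    rw [← hτ, le_div_iff₀ (by positivity)] at this
    exact this
  have h3 : |τ * r| ≤ 1 := by
    rw [abs_of_nonneg (by positivity)]
    nlinarith
  have h4 := (abs_le.1 (Real.abs_exp_sub_one_sub_id_le h3)).2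
  have h5 := h τ hτ0
  have h6 : τ * A ≤ τ * (r + τ * r ^ 2) := by nlinarith
  have h7 := le_of_mul_le_mul_left h6 hτ0
  nlinarith

/-- Maximizing `∏ (u (f j) + u (g j))` over the simplex `∑ u κ = #s` yields nonnegative
multipliers satisfying the first order conditions. -/
theorem exists_balanced_weights {ι J : Type*} [Fintype ι] [DecidableEq ι] (κ : ι → ℝ)
    (hκ : ∀ i, 0 ≤ κ i) (s : Finset J) (hs : s.Nonempty) (f g : J → ι)
    (hf : ∀ j ∈ s, 0 < κ (f j)) (hg : ∀ j ∈ s, 0 < κ (g j)) :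
    ∃ u : ι → ℝ, (∀ i, 0 ≤ u i) ∧ (∀ j ∈ s, 0 < u (f j) + u (g j)) ∧
      ∑ i, u i * κ i = s.card ∧
      ∀ i, 0 < κ i → ∑ j ∈ s, ((Pi.single i (1 : ℝ) : ι → ℝ) (f j) +
        (Pi.single i (1 : ℝ) : ι → ℝ) (g j)) * (u (f j) + u (g j))⁻¹ ≤ κ i := by
  -- The objective is homogeneous of degree `#s`; by Euler's identity this level of the constraint
  -- makes its Lagrange multiplier for `log G` equal to `1`.
  set N : ℝ := (s.card : ℝ) with hN
  have hN0 : 0 < N := by rw [hN]; exact_mod_cast hs.card_pos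
  -- Coordinates with `κ i = 0` are not controlled by the sum; setting them to zero makes `K`
  -- compact.
  set K : Set (ι → ℝ) := {u | (∀ i, 0 ≤ u i) ∧ (∀ i, κ i = 0 → u i = 0) ∧ ∑ i, u i * κ i = N}
    with hK
  set G : (ι → ℝ) → ℝ := fun u => ∏ j ∈ s, (u (f j) + u (g j)) with hG
  have hKc : IsCompact K := by
    refine (isCompact_Icc (a := (0 : ι → ℝ)) (b := fun i => N / κ i)).of_isClosed_subset ?_ ?_
    · simp only [hK, Set.ofPred_and, Set.ofPred_forall]
      refine (isClosed_iInter fun i => ?_).inter ((isClosed_iInter fun i => isClosed_iInter fun _ =>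
        ?_).inter ?_)
      · exact isClosed_le continuous_const (continuous_apply i)
      · exact isClosed_eq (continuous_apply i) continuous_const
      · exact isClosed_eq (by fun_prop) continuous_const
    · rintro u ⟨h0, h1, h2⟩
      refine ⟨fun i => h0 i, fun i => ?_⟩
      rcases (hκ i).eq_or_lt with h | h
      · simp [h1 i h.symm, ← h]
      · rw [le_div_iff₀ h, ← h2]
        exact Finset.single_le_sum (f := fun i => u i * κ i)
          (fun j _ => mul_nonneg (h0 j) (hκ j)) (Finset.mem_univ i)
  have hGc : Continuous G := by fun_prop
  obtain ⟨j₀, hj₀⟩ := hs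
  -- a point of positive objective
  obtain ⟨w, hwK, hwG⟩ : ∃ w ∈ K, 0 < G w := by
    set S := ∑ i, (if κ i = 0 then 0 else 1) * κ i with hS
    have hS0 : 0 < S := by
      refine Finset.sum_pos' (fun i _ => ?_) ⟨f j₀, Finset.mem_univ _, ?_⟩
      · split_ifs <;> simp [hκ i]
      · simp [(hf j₀ hj₀).ne', hf j₀ hj₀]
    refine ⟨fun i => N / S * (if κ i = 0 then 0 else 1), ⟨fun i => ?_, fun i hi => ?_, ?_⟩, ?_⟩
    · dsimp only
      split_ifs <;> positivity
    · simp [hi]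
    · simp only [mul_assoc]
      rw [← Finset.mul_sum, ← hS]
      field_simp
    · refine Finset.prod_pos fun j hj => ?_
      simp only [(hf j hj).ne', (hg j hj).ne', if_false]
      positivity
  obtain ⟨u, huK, hu⟩ := hKc.exists_isMaxOn ⟨w, hwK⟩ hGc.continuousOn
  have hGu : 0 < G u := hwG.trans_le (hu hwK)
  obtain ⟨hu0, hu1, hu2⟩ := huK
  have hpos : ∀ j ∈ s, 0 < u (f j) + u (g j) := fun j hj =>
    lt_of_le_of_ne (add_nonneg (hu0 _) (hu0 _))
      (Ne.symm (Finset.prod_ne_zero_iff.1 hGu.ne' j hj))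
  refine ⟨u, hu0, hpos, hu2, fun i hi => ?_⟩
  set e : ι → ℝ := Pi.single i 1 with he
  have he0 : ∀ k, 0 ≤ e k := fun k => by
    rw [he, Pi.single_apply]; split_ifs <;> norm_num
  -- Moving from `u` in direction `e` and rescaling back to the simplex cannot increase `G`. By
  -- homogeneity the product of the relative increments is at most `(1 + τ * κ i / N) ^ N ≤ exp (τ *
  -- κ i)`, and it is at least one plus their sum.
  refine le_of_one_add_mul_le_exp (hκ i) fun τ hτ => ?_
  have hNτ : 0 < N + τ * κ i := by positivity
  -- the perturbed point, rescaled to the simplex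
  have hv : (fun k => N / (N + τ * κ i) * (u k + τ * e k)) ∈ K := by
    refine ⟨fun k => ?_, fun k hk => ?_, ?_⟩
    · have := hu0 k; have := he0 k; positivity
    · have hki : k ≠ i := by rintro rfl; exact hi.ne' hk
      simp [hu1 k hk, he, hki]
    · have h1 : ∑ k, e k * κ k = κ i := by simp [he, Pi.single_apply]
      have h2 : ∑ k, N / (N + τ * κ i) * (u k + τ * e k) * κ k
          = N / (N + τ * κ i) * (∑ k, u k * κ k + τ * ∑ k, e k * κ k) := by
        rw [Finset.mul_sum, ← Finset.sum_add_distrib, Finset.mul_sum]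
        exact Finset.sum_congr rfl fun k _ => by ring
      rw [h2, h1, hu2]
      field_simp
  have hle : G _ ≤ G u := hu hv
  have hfac : ∀ j ∈ s, N / (N + τ * κ i) * (u (f j) + τ * e (f j)) +
      N / (N + τ * κ i) * (u (g j) + τ * e (g j)) =
      N / (N + τ * κ i) * ((1 + τ * ((e (f j) + e (g j)) * (u (f j) + u (g j))⁻¹)) *
        (u (f j) + u (g j))) := fun j hj => by
    have := (hpos j hj).ne'
    field_simp
    ring
  have hGv : (N / (N + τ * κ i)) ^ s.card *
      ((∏ j ∈ s, (1 + τ * ((e (f j) + e (g j)) * (u (f j) + u (g j))⁻¹))) * G u) ≤ G u := by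
    refine le_of_eq_of_le ?_ hle
    simp only [hG]
    rw [Finset.prod_congr rfl hfac, Finset.prod_mul_distrib, Finset.prod_mul_distrib,
      Finset.prod_const]
  rw [← mul_assoc] at hGv
  have h1 := le_of_mul_le_mul_right (hGv.trans_eq (one_mul _).symm) hGu
  have h2 : 1 + τ * ∑ j ∈ s, (e (f j) + e (g j)) * (u (f j) + u (g j))⁻¹ ≤
      ∏ j ∈ s, (1 + τ * ((e (f j) + e (g j)) * (u (f j) + u (g j))⁻¹)) := by
    rw [Finset.mul_sum]
    refine one_add_sum_le_prod_one_add s _ fun j hj => ?_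
    have := he0 (f j); have := he0 (g j); have := hpos j hj
    positivity
  have h3 : ((N + τ * κ i) / N) ^ s.card ≤ Real.exp (τ * κ i) := by
    have h4 : (N + τ * κ i) / N ≤ Real.exp (τ * κ i / N) := by
      have h5 := Real.add_one_le_exp (τ * κ i / N)
      have h6 : (N + τ * κ i) / N = τ * κ i / N + 1 := by field_simp; ring
      rwa [h6]
    calc ((N + τ * κ i) / N) ^ s.card ≤ Real.exp (τ * κ i / N) ^ s.card := by gcongr
      _ = Real.exp (τ * κ i) := by
        rw [← Real.exp_nat_mul, ← hN]
        congr 1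
        field_simp
  refine h2.trans (le_trans ?_ h3)
  have h7 : (N / (N + τ * κ i)) ^ s.card = (((N + τ * κ i) / N) ^ s.card)⁻¹ := by
    rw [← inv_pow, inv_div]
  rw [h7, inv_mul_le_iff₀ (by positivity), mul_one] at h1
  exact h1

variable {α β : Type*} [Fintype α] [Fintype β]

/-- `X` is the optimal gain for the nonnegative row bounds `r` and column bounds `c`: it vanishes
where a bound vanishes, and elsewhere satisfies the optimality conditions for maximizing
`∑ log (X (a, b))` with nonnegative multipliers. -/
structure IsBalanced (r : α → ℝ) (c : β → ℝ) (X : α × β → ℝ) : Prop where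
  eq_zero : ∀ a b, ¬(0 < r a ∧ 0 < c b) → X (a, b) = 0
  row_le : ∀ a, ∑ b, X (a, b) ≤ r a
  col_le : ∀ b, ∑ a, X (a, b) ≤ c b
  multipliers : ∃ (μ : α → ℝ) (ν : β → ℝ), (∀ a, 0 ≤ μ a) ∧ (∀ b, 0 ≤ ν b) ∧
    (∀ a b, 0 < r a → 0 < c b → 0 < μ a + ν b ∧ X (a, b) = (μ a + ν b)⁻¹) ∧
    ∑ a, μ a * r a + ∑ b, ν b * c b = ∑ a, ∑ b, (if 0 < r a ∧ 0 < c b then 1 else 0)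

/-- The multipliers of rows and columns are the weights on `α ⊕ β`, with one factor of the product
for each pair of positive bounds. The first order inequalities become the row and column bounds, and
the simplex equation becomes the total multiplier identity. -/
theorem exists_isBalanced (r : α → ℝ) (c : β → ℝ) (hr : ∀ a, 0 ≤ r a) (hc : ∀ b, 0 ≤ c b)
    (hr' : ∃ a, 0 < r a) (hc' : ∃ b, 0 < c b) : ∃ X, IsBalanced r c X := by
  classical
  set s : Finset (α × β) := Finset.univ.filter fun j => 0 < r j.1 ∧ 0 < c j.2 with hs
  have hmem : ∀ j, j ∈ s ↔ 0 < r j.1 ∧ 0 < c j.2 := by simp [hs]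
  obtain ⟨a₀, ha₀⟩ := hr'
  obtain ⟨b₀, hb₀⟩ := hc'
  obtain ⟨u, hu0, hupos, husum, hule⟩ := exists_balanced_weights (Sum.elim r c)
    (by rintro (a | b); exacts [hr a, hc b]) s ⟨(a₀, b₀), by simp [hmem, ha₀, hb₀]⟩
    (fun j => Sum.inl j.1) (fun j => Sum.inr j.2) (fun j hj => ((hmem j).1 hj).1)
    (fun j hj => ((hmem j).1 hj).2)
  set X : α × β → ℝ := fun j => if 0 < r j.1 ∧ 0 < c j.2 then (u (.inl j.1) + u (.inr j.2))⁻¹ else 0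
    with hX
  refine ⟨X, fun a b h => by simp only [hX, if_neg h], fun a => ?_, fun b => ?_,
    fun a => u (.inl a), fun b => u (.inr b), fun _ => hu0 _, fun _ => hu0 _,
    fun a b ha hb => ⟨hupos (a, b) (by simp [hmem, ha, hb]), by simp only [hX, ha, hb, true_and, if_true]⟩, ?_⟩
  · rcases (hr a).eq_or_lt with h | h
    · simp [hX, ← h]
    · refine le_of_eq_of_le ?_ (hule (.inl a) h)
      rw [hs, Finset.sum_filter, Fintype.sum_prod_type, Finset.sum_eq_single a]
      · simp [hX]
      · intro a' _ ha'
        simp [ha']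
      · simp
  · rcases (hc b).eq_or_lt with h | h
    · simp [hX, ← h]
    · refine le_of_eq_of_le ?_ (hule (.inr b) h)
      rw [hs, Finset.sum_filter, Fintype.sum_prod_type_right, Finset.sum_eq_single b]
      · simp [hX]
      · intro b' _ hb'
        simp [hb']
      · simp
  · rw [Fintype.sum_sum_type] at husum
    simp only [Sum.elim_inl, Sum.elim_inr] at husum
    rw [husum, ← Fintype.sum_prod_type' (f := fun a b => if 0 < r a ∧ 0 < c b then (1 : ℝ) else 0),
      hs, Finset.card_filter]
    push_cast
    rfl

/-! ### Balanced gains and hyperparameters -/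

theorem IsBalanced.nonneg {r : α → ℝ} {c : β → ℝ} {X : α × β → ℝ} (h : IsBalanced r c X)
    (j : α × β) : 0 ≤ X j := by
  obtain ⟨μ, ν, -, -, h1, -⟩ := h.multipliers
  by_cases hj : 0 < r j.1 ∧ 0 < c j.2
  · obtain ⟨h2, h3⟩ := h1 j.1 j.2 hj.1 hj.2
    rw [show j = (j.1, j.2) from rfl, h3]
    positivity
  · exact (h.eq_zero j.1 j.2 hj).ge

theorem IsBalanced.pos {r : α → ℝ} {c : β → ℝ} {X : α × β → ℝ} (h : IsBalanced r c X)
    {a : α} {b : β} (ha : 0 < r a) (hb : 0 < c b) : 0 < X (a, b) := by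
  obtain ⟨μ, ν, -, -, h1, -⟩ := h.multipliers
  obtain ⟨h2, h3⟩ := h1 a b ha hb
  rw [h3]
  positivity

/-- A balanced gain has the form `λ γ / (λ + γ)`. -/
theorem IsBalanced.exists_eq_div {r : α → ℝ} {c : β → ℝ} {X : α × β → ℝ} (h : IsBalanced r c X)
    (hr' : ∃ a, 0 < r a) (hc' : ∃ b, 0 < c b) :
    ∃ (l : α → ℝ) (γ : β → ℝ), (∀ a, 0 ≤ l a) ∧ (∀ b, 0 ≤ γ b) ∧ (∀ a, 0 < l a ↔ 0 < r a) ∧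
      (∀ b, 0 < γ b ↔ 0 < c b) ∧ ∀ a b, X (a, b) = l a * γ b / (l a + γ b) := by
  classical
  obtain ⟨μ, ν, -, -, h1, -⟩ := h.multipliers
  obtain ⟨a₀, ha₀, hamin⟩ := Finset.exists_min_image (Finset.univ.filter fun a => 0 < r a) μ
    (by obtain ⟨a, ha⟩ := hr'; exact ⟨a, by simpa using ha⟩)
  obtain ⟨b₀, hb₀, hbmin⟩ := Finset.exists_min_image (Finset.univ.filter fun b => 0 < c b) ν
    (by obtain ⟨b, hb⟩ := hc'; exact ⟨b, by simpa using hb⟩)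
  simp only [Finset.mem_filter, Finset.mem_univ, true_and] at ha₀ hamin hb₀ hbmin
  have h0 := (h1 a₀ b₀ ha₀ hb₀).1
  -- Only the sums `μ a + ν b` matter, so a constant may be moved from one family to the other. This
  -- `δ` makes both minima equal to `(μ a₀ + ν b₀) / 2 > 0`, and the shifted multipliers can be
  -- inverted.
  set δ := (μ a₀ - ν b₀) / 2 with hδ
  have hμ : ∀ a, 0 < r a → 0 < μ a - δ := fun a ha => by
    have := hamin a ha; rw [hδ]; linarith
  have hν : ∀ b, 0 < c b → 0 < ν b + δ := fun b hb => by
    have := hbmin b hb; rw [hδ]; linarith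
  refine ⟨fun a => if 0 < r a then (μ a - δ)⁻¹ else 0, fun b => if 0 < c b then (ν b + δ)⁻¹ else 0,
    fun a => ?_, fun b => ?_, fun a => ?_, fun b => ?_, fun a b => ?_⟩
  · dsimp only; split_ifs with ha
    exacts [(inv_pos.2 (hμ a ha)).le, le_rfl]
  · dsimp only; split_ifs with hb
    exacts [(inv_pos.2 (hν b hb)).le, le_rfl]
  · dsimp only; split_ifs with ha
    · simp [ha, hμ a ha]
    · simp [ha]
  · dsimp only; split_ifs with hb
    · simp [hb, hν b hb]
    · simp [hb]
  · by_cases hab : 0 < r a ∧ 0 < c b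
    · have h2 := hμ a hab.1
      have h3 := hν b hab.2
      obtain ⟨h4, h5⟩ := h1 a b hab.1 hab.2
      simp only [if_pos hab.1, if_pos hab.2, h5]
      have h6 : μ a + ν b = (μ a - δ) + (ν b + δ) := by ring
      rw [h6]
      generalize μ a - δ = x at *
      generalize ν b + δ = y at *
      field_simp
      ring
    · rw [h.eq_zero a b hab]
      dsimp only
      rcases not_and_or.1 hab with hh | hh <;> simp [hh]

/-- Every gain `λ γ / (λ + γ)` is balanced for its own row and column sums. -/
theorem exists_isBalanced_div (l : α → ℝ) (γ : β → ℝ) (hl : ∀ a, 0 ≤ l a) (hγ : ∀ b, 0 ≤ γ b)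
    (hl' : ∃ a, 0 < l a) (hγ' : ∃ b, 0 < γ b) :
    ∃ (r : α → ℝ) (c : β → ℝ), (∀ a, 0 ≤ r a) ∧ (∀ b, 0 ≤ c b) ∧ (∀ a, 0 < r a ↔ 0 < l a) ∧
      (∀ b, 0 < c b ↔ 0 < γ b) ∧ IsBalanced r c fun j => l j.1 * γ j.2 / (l j.1 + γ j.2) := by
  obtain ⟨a₀, ha₀⟩ := hl'
  obtain ⟨b₀, hb₀⟩ := hγ'
  set X : α × β → ℝ := fun j => l j.1 * γ j.2 / (l j.1 + γ j.2) with hX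
  have hX0 : ∀ j, 0 ≤ X j := fun j => by
    have := hl j.1; have := hγ j.2
    simp only [hX]; positivity
  have hXpos : ∀ a b, 0 < l a → 0 < γ b → 0 < X (a, b) := fun a b ha hb => by
    simp only [hX]; positivity
  have hr : ∀ a, 0 < ∑ b, X (a, b) ↔ 0 < l a := fun a => by
    constructor
    · intro h
      by_contra! ha
      have : l a = 0 := le_antisymm ha (hl a)
      simp [hX, this] at h
    · intro ha
      exact Finset.sum_pos' (fun b _ => hX0 _) ⟨b₀, Finset.mem_univ _, hXpos a b₀ ha hb₀⟩
  have hc : ∀ b, 0 < ∑ a, X (a, b) ↔ 0 < γ b := fun b => by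
    constructor
    · intro h
      by_contra! hb
      have : γ b = 0 := le_antisymm hb (hγ b)
      simp [hX, this] at h
    · intro hb
      exact Finset.sum_pos' (fun a _ => hX0 _) ⟨a₀, Finset.mem_univ _, hXpos a₀ b ha₀ hb⟩
  -- The multipliers are the reciprocals, as `λ γ / (λ + γ) = (λ⁻¹ + γ⁻¹)⁻¹`. A zero parameter gets
  -- the default reciprocal `0`; its row or column has bound `0`, so this is harmless.
  refine ⟨fun a => ∑ b, X (a, b), fun b => ∑ a, X (a, b), fun a => Finset.sum_nonneg fun _ _ => hX0 _,
    fun b => Finset.sum_nonneg fun _ _ => hX0 _, hr, hc, fun a b hab => ?_, fun a => le_rfl,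
    fun b => le_rfl, fun a => (l a)⁻¹, fun b => (γ b)⁻¹, fun a => inv_nonneg.2 (hl a),
    fun b => inv_nonneg.2 (hγ b), fun a b ha hb => ?_, ?_⟩
  · rw [hr, hc, not_and_or, not_lt, not_lt] at hab
    rcases hab with h | h
    · simp [hX, le_antisymm h (hl a)]
    · simp [hX, le_antisymm h (hγ b)]
  · have h1 := (hr a).1 ha
    have h2 := (hc b).1 hb
    refine ⟨by positivity, ?_⟩
    simp only [hX]
    field_simp
    ring
  · simp only [hr, hc, Finset.mul_sum]
    rw [Finset.sum_comm (s := (Finset.univ : Finset β)), ← Finset.sum_add_distrib]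
    refine Finset.sum_congr rfl fun a _ => ?_
    rw [← Finset.sum_add_distrib]
    refine Finset.sum_congr rfl fun b _ => ?_
    by_cases ha : 0 < l a
    · by_cases hb : 0 < γ b
      · simp only [hX, ha, hb, and_self, if_true]
        field_simp
        ring
      · simp [hX, le_antisymm (not_lt.1 hb) (hγ b)]
    · simp [hX, le_antisymm (not_lt.1 ha) (hl a)]

/-! ### Continuity of balanced gains in the bounds -/

/-- Since `(u - 1) ^ 2 = u * (u + u⁻¹ - 2)`, the bound `1` gives `u < 3`, and the bound `η ^ 2 / 3`
then finishes. -/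
theorem abs_sub_one_lt_of_add_inv_lt {u η : ℝ} (hu : 0 < u) (hη : 0 < η)
    (h : u + u⁻¹ - 2 < min 1 (η ^ 2 / 3)) : |u - 1| < η := by
  have h1 := h.trans_le (min_le_left _ _)
  have h2 := h.trans_le (min_le_right _ _)
  have hi : 0 < u⁻¹ := inv_pos.2 hu
  have h3 : (u - 1) ^ 2 = u * (u + u⁻¹ - 2) := by field_simp; ring
  refine abs_lt_of_sq_lt_sq ?_ hη.le
  rw [h3]
  nlinarith [sq_nonneg η]

variable {α β : Type*} [Fintype α] [Fintype β]

/-- Any gain `Z` is controlled by its row and column sums through the multipliers of a balanced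
gain. -/
theorem IsBalanced.sum_div_le {r : α → ℝ} {c : β → ℝ} {X : α × β → ℝ} (h : IsBalanced r c X) :
    ∃ (μ : α → ℝ) (ν : β → ℝ), (∀ a, 0 ≤ μ a) ∧ (∀ b, 0 ≤ ν b) ∧
    (∑ a, μ a * r a + ∑ b, ν b * c b = ∑ a, ∑ b, (if 0 < r a ∧ 0 < c b then 1 else 0)) ∧
    ∀ Z : α × β → ℝ, (∀ j, 0 ≤ Z j) → ∑ j : α × β, (if 0 < r j.1 ∧ 0 < c j.2 then Z j / X j else 0) ≤
      ∑ a, μ a * ∑ b, Z (a, b) + ∑ b, ν b * ∑ a, Z (a, b) := by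
  obtain ⟨μ, ν, hμ, hν, h1, h2⟩ := h.multipliers
  refine ⟨μ, ν, hμ, hν, h2, fun Z hZ => ?_⟩
  have h4 : ∑ a, μ a * ∑ b, Z (a, b) + ∑ b, ν b * ∑ a, Z (a, b) =
      ∑ j : α × β, (μ j.1 + ν j.2) * Z j := by
    simp only [add_mul, Finset.sum_add_distrib]
    rw [Fintype.sum_prod_type, Fintype.sum_prod_type_right]
    simp only [Finset.mul_sum]
  rw [h4]
  refine Finset.sum_le_sum fun j _ => ?_
  split_ifs with hj
  · rw [div_eq_inv_mul, show X j = X (j.1, j.2) from rfl, (h1 _ _ hj.1 hj.2).2, inv_inv]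
  · exact mul_nonneg (add_nonneg (hμ _) (hν _)) (hZ j)

/-- Balanced gains depend continuously on the bounds, up to the boundary of the orthant. -/
theorem IsBalanced.tendsto {ι : Type*} {l : Filter ι} {r : α → ℝ} {c : β → ℝ} {X : α × β → ℝ}
    (h : IsBalanced r c X) (hr : ∀ a, 0 ≤ r a) (hc : ∀ b, 0 ≤ c b)
    {r' : ι → α → ℝ} {c' : ι → β → ℝ} {X' : ι → α × β → ℝ}
    (hr' : ∀ a, Tendsto (fun i => r' i a) l (𝓝 (r a)))
    (hc' : ∀ b, Tendsto (fun i => c' i b) l (𝓝 (c b)))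
    (hrpos : ∀ᶠ i in l, ∀ a, 0 < r' i a) (hcpos : ∀ᶠ i in l, ∀ b, 0 < c' i b)
    (hX' : ∀ᶠ i in l, IsBalanced (r' i) (c' i) (X' i)) (j : α × β) :
    Tendsto (fun i => X' i j) l (𝓝 (X j)) := by
  classical
  obtain ⟨a₀, b₀⟩ := j
  -- Where a bound vanishes in the limit, the entry is squeezed between `0` and that bound.
  by_cases hj : ¬(0 < r a₀ ∧ 0 < c b₀)
  · rw [h.eq_zero _ _ hj]
    rcases not_and_or.1 hj with hh | hh
    · have h0 : r a₀ = 0 := le_antisymm (not_lt.1 hh) (hr _)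
      refine tendsto_of_tendsto_of_tendsto_of_le_of_le' tendsto_const_nhds (h0 ▸ hr' a₀)
        (hX'.mono fun i hi => hi.nonneg _) (hX'.mono fun i hi => ?_)
      exact (Finset.single_le_sum (f := fun b => X' i (a₀, b)) (fun b _ => hi.nonneg _)
        (Finset.mem_univ b₀)).trans (hi.row_le a₀)
    · have h0 : c b₀ = 0 := le_antisymm (not_lt.1 hh) (hc _)
      refine tendsto_of_tendsto_of_tendsto_of_le_of_le' tendsto_const_nhds (h0 ▸ hc' b₀)
        (hX'.mono fun i hi => hi.nonneg _) (hX'.mono fun i hi => ?_)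
      exact (Finset.single_le_sum (f := fun a => X' i (a, b₀)) (fun a _ => hi.nonneg _)
        (Finset.mem_univ a₀)).trans (hi.col_le b₀)
  push Not at hj
  obtain ⟨μ, ν, hμ, hν, hsum, hZ⟩ := h.sum_div_le
  set n : ℝ := ∑ a, ∑ b, (if 0 < r a ∧ 0 < c b then 1 else 0) with hn
  have hn' : n = ∑ j : α × β, (if 0 < r j.1 ∧ 0 < c j.2 then 1 else 0) := by
    rw [hn, Fintype.sum_prod_type]
  have hn0 : 0 ≤ n := by
    rw [hn']; exact Finset.sum_nonneg fun _ _ => by split_ifs <;> norm_num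
  -- first estimate: feasibility of `X'` against the multipliers of `X`
  have hB : Tendsto (fun i => ∑ a, μ a * r' i a + ∑ b, ν b * c' i b) l (𝓝 n) := by
    rw [← hsum]
    exact (tendsto_finsetSum _ fun a _ => (hr' a).const_mul _).add
      (tendsto_finsetSum _ fun b _ => (hc' b).const_mul _)
  have hfirst : ∀ᶠ i in l, ∑ j : α × β, (if 0 < r j.1 ∧ 0 < c j.2 then X' i j / X j else 0) ≤
      ∑ a, μ a * r' i a + ∑ b, ν b * c' i b := by
    filter_upwards [hX'] with i hi
    refine (hZ _ hi.nonneg).trans ?_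
    gcongr with a _ b _
    exacts [hμ a, hi.row_le a, hν b, hi.col_le b]
  -- second estimate: near-feasibility of `X` against the multipliers of `X'`
  have hsecond : ∀ ρ : ℝ, 0 < ρ → ρ < 1 → ∀ᶠ i in l,
      ρ * ∑ j : α × β, (if 0 < r j.1 ∧ 0 < c j.2 then X j / X' i j else 0) ≤ n := by
    intro ρ hρ0 hρ1
    have hrow : ∀ᶠ i in l, ∀ a, 0 < r a →
        ρ * r a + ∑ b, (if 0 < c b then 0 else c' i b) < r' i a := by
      rw [eventually_all]
      intro a
      by_cases ha : 0 < r a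
      · have h1 : Tendsto (fun i => ρ * r a + ∑ b, (if 0 < c b then 0 else c' i b)) l
            (𝓝 (ρ * r a + ∑ b : β, (0 : ℝ))) := by
          refine tendsto_const_nhds.add (tendsto_finsetSum _ fun b _ => ?_)
          split_ifs with hb
          · exact tendsto_const_nhds
          · exact le_antisymm (not_lt.1 hb) (hc b) ▸ hc' b
        refine (h1.eventually_lt (hr' a) ?_).mono fun i hi _ => hi
        simp only [Finset.sum_const_zero, add_zero]
        nlinarith
      · exact Eventually.of_forall fun i hi => absurd hi ha
    have hcol : ∀ᶠ i in l, ∀ b, 0 < c b →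
        ρ * c b + ∑ a, (if 0 < r a then 0 else r' i a) < c' i b := by
      rw [eventually_all]
      intro b
      by_cases hb : 0 < c b
      · have h1 : Tendsto (fun i => ρ * c b + ∑ a, (if 0 < r a then 0 else r' i a)) l
            (𝓝 (ρ * c b + ∑ a : α, (0 : ℝ))) := by
          refine tendsto_const_nhds.add (tendsto_finsetSum _ fun a _ => ?_)
          split_ifs with ha
          · exact tendsto_const_nhds
          · exact le_antisymm (not_lt.1 ha) (hr a) ▸ hr' a
        refine (h1.eventually_lt (hc' b) ?_).mono fun i hi _ => hi
        simp only [Finset.sum_const_zero, add_zero]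
        nlinarith
      · exact Eventually.of_forall fun i hi => absurd hi hb
    filter_upwards [hX', hrpos, hcpos, hrow, hcol] with i hi hri hci hrowi hcoli
    obtain ⟨μ', ν', hμ', hν', hsum', hZ'⟩ := hi.sum_div_le
    have hXi : ∀ j, 0 < X' i j := fun j => hi.pos (hri j.1) (hci j.2)
    -- The test gain copies `X'` off the support of `X`. In a row with positive limit bound these
    -- copied entries are at most the column bounds `c' i b`, which tend to `0`, and `ρ < 1` leaves
    -- room for them; a row with limit bound `0` is just a row of `X'`. Columns are symmetric.
    set Z : α × β → ℝ := fun j => ρ * X j + (if 0 < r j.1 ∧ 0 < c j.2 then 0 else X' i j) with hZdef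
    have hZ0 : ∀ j, 0 ≤ Z j := fun j => by
      have := h.nonneg j; have := (hXi j).le
      simp only [hZdef]; split_ifs <;> positivity
    have hZrow : ∀ a, ∑ b, Z (a, b) ≤ r' i a := fun a => by
      by_cases ha : 0 < r a
      · refine le_trans ?_ (hrowi a ha).le
        simp only [hZdef, Finset.sum_add_distrib, ← Finset.mul_sum]
        gcongr with b _
        · exact h.row_le a
        · simp only [ha, true_and]
          split_ifs
          · exact le_rfl
          · exact (Finset.single_le_sum (f := fun a => X' i (a, b)) (fun a _ => hi.nonneg _)
              (Finset.mem_univ a)).trans (hi.col_le b)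
      · refine le_trans (Finset.sum_le_sum fun b _ => ?_) (hi.row_le a)
        simp [hZdef, ha, h.eq_zero a b (fun hh => ha hh.1)]
    have hZcol : ∀ b, ∑ a, Z (a, b) ≤ c' i b := fun b => by
      by_cases hb : 0 < c b
      · refine le_trans ?_ (hcoli b hb).le
        simp only [hZdef, Finset.sum_add_distrib, ← Finset.mul_sum]
        gcongr with a _
        · exact h.col_le b
        · simp only [hb, and_true]
          split_ifs
          · exact le_rfl
          · exact (Finset.single_le_sum (f := fun b => X' i (a, b)) (fun b _ => hi.nonneg _)
              (Finset.mem_univ b)).trans (hi.row_le a)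
      · refine le_trans (Finset.sum_le_sum fun a _ => ?_) (hi.col_le b)
        simp [hZdef, hb, h.eq_zero a b (fun hh => hb hh.2)]
    have h1 := hZ' Z hZ0
    have h2 : ∑ a, μ' a * ∑ b, Z (a, b) + ∑ b, ν' b * ∑ a, Z (a, b) ≤
        ∑ a, μ' a * r' i a + ∑ b, ν' b * c' i b := by
      gcongr with a _ b _
      exacts [hμ' a, hZrow a, hν' b, hZcol b]
    have h3 := h1.trans (h2.trans_eq hsum')
    simp only [hri, hci, and_self, if_true] at h3
    rw [← Fintype.sum_prod_type' (f := fun (_ : α) (_ : β) => (1 : ℝ))] at h3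
    -- Each pair off the support contributes exactly `1` to the sum and cancels from the total
    -- count, which leaves `n`.
    have h4 : ∀ j, Z j / X' i j = ρ * (if 0 < r j.1 ∧ 0 < c j.2 then X j / X' i j else 0) +
        (1 - (if 0 < r j.1 ∧ 0 < c j.2 then 1 else 0)) := fun j => by
      have := (hXi j).ne'
      simp only [hZdef]
      split_ifs with hj
      · field_simp; ring
      · rw [show X j = 0 from h.eq_zero j.1 j.2 hj]
        field_simp; ring
    simp only [h4, Finset.sum_add_distrib, Finset.sum_sub_distrib, ← Finset.mul_sum] at h3
    rw [← hn'] at h3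
    linarith
  -- combination
  have hX0 : 0 < X (a₀, b₀) := h.pos hj.1 hj.2
  have hratio : Tendsto (fun i => X' i (a₀, b₀) / X (a₀, b₀)) l (𝓝 1) := by
    rw [Metric.tendsto_nhds]
    intro η hη
    set ε := min 1 (η ^ 2 / 3) with hε
    have hε0 : 0 < ε := lt_min one_pos (by positivity)
    -- With `ρ = (1 + δ)⁻¹` the second estimate reads `∑ X / X' ≤ (1 + δ) * n`, so its excess over
    -- `n` is below `ε / 2`; the first estimate provides the other half.
    set δ := ε / (2 * (n + 1)) with hδ
    have hδ0 : 0 < δ := by positivity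
    have hδn : n * δ < ε / 2 := by
      rw [hδ, mul_div_assoc', div_lt_div_iff₀ (by positivity) (by positivity)]
      nlinarith
    have h2 := hsecond (1 + δ)⁻¹ (by positivity) (inv_lt_one_of_one_lt₀ (by linarith))
    have h3 : ∀ᶠ i in l, ∑ a, μ a * r' i a + ∑ b, ν b * c' i b < n + ε / 2 :=
      hB.eventually_lt_const (by linarith)
    filter_upwards [hfirst, h2, h3, hX', hrpos, hcpos] with i h1 h2 h3 hi hri hci
    rw [Real.dist_eq]
    have hXi : ∀ j, 0 < X' i j := fun j => hi.pos (hri j.1) (hci j.2)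
    refine abs_sub_one_lt_of_add_inv_lt (div_pos (hXi _) hX0) hη ?_
    rw [← hε, inv_div]
    rw [inv_mul_le_iff₀ (by positivity)] at h2
    -- Every summand is nonnegative, so a single one is bounded by the whole sum, which the two
    -- estimates make smaller than `ε`.
    have h4 : X' i (a₀, b₀) / X (a₀, b₀) + X (a₀, b₀) / X' i (a₀, b₀) - 2 ≤
        ∑ j : α × β, ((if 0 < r j.1 ∧ 0 < c j.2 then X' i j / X j else 0) +
          (if 0 < r j.1 ∧ 0 < c j.2 then X j / X' i j else 0) -
          2 * (if 0 < r j.1 ∧ 0 < c j.2 then 1 else 0)) := by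
      refine le_of_eq_of_le ?_ (Finset.single_le_sum (f := fun j : α × β =>
        ((if 0 < r j.1 ∧ 0 < c j.2 then X' i j / X j else 0) +
          (if 0 < r j.1 ∧ 0 < c j.2 then X j / X' i j else 0) -
          2 * (if 0 < r j.1 ∧ 0 < c j.2 then 1 else 0))) (fun j _ => ?_) (Finset.mem_univ (a₀, b₀)))
      · simp [hj.1, hj.2]
      · split_ifs with hj'
        · have h5 : 0 < X j := h.pos hj'.1 hj'.2
          have h6 := hXi j
          have h7 : X' i j / X j + X j / X' i j - 2 * 1 = (X' i j - X j) ^ 2 / (X j * X' i j) := by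
            field_simp; ring
          rw [h7]; positivity
        · simp
    rw [Finset.sum_sub_distrib, Finset.sum_add_distrib, ← Finset.mul_sum, ← hn'] at h4
    nlinarith
  have := hratio.mul_const (X (a₀, b₀))
  simpa [div_mul_cancel₀ _ hX0.ne'] using this

/-! ### Standard Gaussian noise -/

/-- Independent standard Gaussian variables indexed by `T`. -/
noncomputable abbrev gaussianNoise (T : Type*) : Measure (T → ℝ) :=
  Measure.infinitePi fun _ : T => gaussianReal 0 1

theorem gaussianNoise_map_eval {T : Type*} (i : T) :
    (gaussianNoise T).map (fun z => z i) = gaussianReal 0 1 :=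
  (measurePreserving_eval_infinitePi (fun _ : T => gaussianReal 0 1) i).map_eq

theorem isGaussianProcess_gaussianNoise (T : Type*) :
    IsGaussianProcess (fun (t : T) (z : T → ℝ) => z t)
      (gaussianNoise T) where
  hasGaussianLaw I := by
    have hind : iIndepFun (fun (t : T) (z : T → ℝ) => z t)
        (gaussianNoise T) :=
      iIndepFun_infinitePi (P := fun _ => gaussianReal 0 1) (X := fun _ => id) fun _ => measurable_id
    refine iIndepFun.hasGaussianLaw (X := fun (i : I) (z : T → ℝ) => z i) (fun i => ⟨?_⟩)
      (hind.precomp Subtype.val_injective)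
    change IsGaussian ((gaussianNoise T).map fun z => z (i : T))
    rw [gaussianNoise_map_eval]
    infer_instance

theorem memLp_gaussianNoise {T : Type*} (i : T) :
    MemLp (fun z : T → ℝ => z i) 2 (gaussianNoise T) :=
  ((isGaussianProcess_gaussianNoise T).hasGaussianLaw_eval i).memLp_two

theorem integral_gaussianNoise {T : Type*} (i : T) : ∫ z, z i ∂(gaussianNoise T) = 0 := by
  have := integral_map (μ := gaussianNoise T) (φ := fun z => z i) (f := fun y : ℝ => y)
    (measurable_pi_apply i).aemeasurable measurable_id.aestronglyMeasurable
  rw [gaussianNoise_map_eval, integral_id_gaussianReal] at this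
  exact this.symm

theorem covariance_gaussianNoise {T : Type*} [DecidableEq T] (i j : T) :
    cov[fun z : T → ℝ => z i, fun z => z j; gaussianNoise T] = if i = j then 1 else 0 := by
  split_ifs with h
  · subst h
    rw [covariance_self (measurable_pi_apply i).aemeasurable]
    have := variance_map (μ := gaussianNoise T) (X := fun y : ℝ => y) (Y := fun z => z i)
      measurable_id.aemeasurable (measurable_pi_apply i).aemeasurable
    rw [gaussianNoise_map_eval, variance_fun_id_gaussianReal, NNReal.coe_one] at this
    exact this.symm
  · exact ((iIndepFun_infinitePi (P := fun _ : T => gaussianReal 0 1) (X := fun _ => id)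
      fun i => measurable_id).indepFun h).covariance_eq_zero (memLp_gaussianNoise i)
        (memLp_gaussianNoise j)

/-! ### Finite-dimensional Gaussian laws and their densities -/

section Gaussian

variable {ι : Type*} [Fintype ι]

omit [Fintype ι] in
theorem memLp_two_eval [Finite ι] {μ : Measure (ι → ℝ)} [IsGaussian μ] (i : ι) :
    MemLp (fun x : ι → ℝ => x i) 2 μ :=
  (IsGaussian.hasGaussianLaw_id (μ := μ)).eval i |>.memLp_two

/-- A Gaussian law on `ℝ^ι` is determined by the means and covariances of the coordinates. -/
theorem gaussian_ext {μ ν : Measure (ι → ℝ)} [IsGaussian μ] [IsGaussian ν]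
    (hmean : ∀ i, ∫ x, x i ∂μ = ∫ x, x i ∂ν)
    (hcov : ∀ i j, cov[fun x : ι → ℝ => x i, fun x => x j; μ] = cov[fun x => x i, fun x => x j; ν]) :
    μ = ν := by
  classical
  -- The characteristic function of a Gaussian law depends on `L` only through the mean and variance
  -- of `L`, which expand in coordinate means and covariances.
  have key : ∀ L : StrongDual ℝ (ι → ℝ), ∀ ρ : Measure (ι → ℝ), IsGaussian ρ →
      (∫ x, L x ∂ρ = ∑ i, L (Pi.single i 1) * ∫ x, x i ∂ρ) ∧
      (Var[L; ρ] = ∑ i, ∑ j, L (Pi.single i 1) * (L (Pi.single j 1) *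
        cov[fun x : ι → ℝ => x i, fun x => x j; ρ])) := by
    intro L ρ hρ
    have hL : (L : (ι → ℝ) → ℝ) = ∑ i, fun x : ι → ℝ => L (Pi.single i 1) * x i := by
      funext x
      have : L x = L (∑ i, x i • Pi.single i (1 : ℝ)) := by
        congr 1
        ext j
        simp [Finset.sum_apply, Pi.single_apply]
      rw [this, map_sum, Finset.sum_apply]
      exact Finset.sum_congr rfl fun i _ => by simp [mul_comm]
    constructor
    · have hint : ∫ x, L x ∂ρ = ∫ x, ∑ i, L (Pi.single i 1) * x i ∂ρ :=
        integral_congr_ae (ae_of_all _ fun x => by simpa using congrFun hL x)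
      rw [hint, integral_finsetSum _ fun i _ => ((memLp_two_eval i).integrable (by norm_num)).const_mul _]
      simp [integral_const_mul]
    · have hvar : Var[L; ρ] = Var[∑ i, fun x : ι → ℝ => L (Pi.single i 1) * x i; ρ] := by rw [← hL]
      rw [hvar, variance_sum fun i => (memLp_two_eval i).const_mul _]
      simp only [covariance_const_mul_left, covariance_const_mul_right]
      exact Finset.sum_congr rfl fun i _ => Finset.sum_congr rfl fun j _ => mul_left_comm _ _ _
  refine Measure.ext_of_charFunDual ?_
  funext L
  rw [IsGaussian.charFunDual_eq, IsGaussian.charFunDual_eq, (key L μ inferInstance).2,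
    (key L ν inferInstance).2, integral_complex_ofReal, integral_complex_ofReal,
    (key L μ inferInstance).1, (key L ν inferInstance).1]
  simp only [hmean, hcov]

/-- The normalizing factor is kept in the exponent, as `κ`, to match the form used in Gibbs'
inequality; its value is never needed afterwards. -/
theorem pi_gaussianReal_eq_densityLaw :
    ∃ κ : ℝ, Measure.pi (fun _ : ι => gaussianReal 0 1) =
      densityLaw fun z : ι → ℝ => Real.exp (-κ - (z ⬝ᵥ z) / 2) := by
  have h2π : 0 < √(2 * Real.pi) := by positivity
  refine ⟨Fintype.card ι * Real.log (√(2 * Real.pi)), ?_⟩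
  have hprod : ∀ z : ι → ℝ, Real.exp (-(Fintype.card ι * Real.log (√(2 * Real.pi))) - (z ⬝ᵥ z) / 2) =
      ∏ i, gaussianPDFReal 0 1 (z i) := by
    intro z
    simp only [gaussianPDFReal, NNReal.coe_one, mul_one, sub_zero]
    rw [Finset.prod_mul_distrib, ← Real.exp_sum, Finset.prod_const, Finset.card_univ, sub_eq_add_neg,
      Real.exp_add, Real.exp_neg, Real.exp_nat_mul, Real.exp_log h2π, inv_pow]
    congr 2
    simp [dotProduct, Finset.sum_div, Finset.sum_neg_distrib, sq, neg_div]
  refine Measure.pi_eq fun s hs => ?_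
  rw [densityLaw, withDensity_apply _ (MeasurableSet.univ_pi hs), volume_pi, Measure.restrict_pi_pi]
  simp only [hprod]
  rw [← ofReal_integral_eq_lintegral_ofReal
    (Integrable.fintype_prod fun i => (integrable_gaussianPDFReal 0 1).restrict)
    (ae_of_all _ fun z => Finset.prod_nonneg fun i _ => gaussianPDFReal_nonneg _ _ _),
    integral_fintype_prod_eq_prod, ENNReal.ofReal_prod_of_nonneg fun i _ =>
      integral_nonneg fun z => gaussianPDFReal_nonneg _ _ _]
  exact Finset.prod_congr rfl fun i _ => (gaussianReal_apply_eq_integral 0 one_ne_zero (s i)).symm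

/-- Change of variables: the constant Jacobian is absorbed into the exponent. -/
theorem densityLaw_map_linear [DecidableEq ι] (S : Matrix ι ι ℝ) (hS : IsUnit S) (κ : ℝ)
    (q : (ι → ℝ) → ℝ) (hq : Measurable q) :
    ∃ κ' : ℝ, (densityLaw fun z : ι → ℝ => Real.exp (-κ - q z)).map (Matrix.toLin' S) =
      densityLaw fun x => Real.exp (-κ' - q (S⁻¹.mulVec x)) := by
  have hdet : LinearMap.det (Matrix.toLin' S) ≠ 0 := by
    rw [LinearMap.det_toLin']; exact ((Matrix.isUnit_iff_isUnit_det S).1 hS).ne_zero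
  have hd : 0 < |(LinearMap.det (Matrix.toLin' S))⁻¹| := abs_pos.2 (inv_ne_zero hdet)
  have hSm : Measurable (Matrix.toLin' S) := (LinearMap.continuous_on_pi _).measurable
  have hSi : Measurable fun x : ι → ℝ => S⁻¹.mulVec x :=
    (Matrix.toLin' S⁻¹).continuous_on_pi.measurable
  refine ⟨κ - Real.log |(LinearMap.det (Matrix.toLin' S))⁻¹|, ?_⟩
  have hmeas : Measurable fun x : ι → ℝ => ENNReal.ofReal (Real.exp (-κ - q (S⁻¹.mulVec x))) := by
    fun_prop
  have h1 : (densityLaw fun z : ι → ℝ => Real.exp (-κ - q z)).map (Matrix.toLin' S) =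
      ((volume : Measure (ι → ℝ)).map (Matrix.toLin' S)).withDensity
        fun x => ENNReal.ofReal (Real.exp (-κ - q (S⁻¹.mulVec x))) := by
    ext s hs
    rw [Measure.map_apply hSm hs, densityLaw, withDensity_apply _ (hSm hs), withDensity_apply _ hs,
      setLIntegral_map hs hmeas hSm]
    refine lintegral_congr fun z => ?_
    rw [Matrix.toLin'_apply, Matrix.mulVec_mulVec, Matrix.nonsing_inv_mul _
      ((Matrix.isUnit_iff_isUnit_det S).1 hS), Matrix.one_mulVec]
  rw [h1, Measure.map_linearMap_addHaar_eq_smul_addHaar _ hdet, withDensity_smul_measure, densityLaw,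
    ← withDensity_smul _ hmeas]
  congr 1
  funext x
  simp only [Pi.smul_apply, smul_eq_mul]
  rw [← ENNReal.ofReal_mul hd.le]
  congr 1
  rw [show -(κ - Real.log |(LinearMap.det (Matrix.toLin' S))⁻¹|) - q (S⁻¹.mulVec x) =
    Real.log |(LinearMap.det (Matrix.toLin' S))⁻¹| + (-κ - q (S⁻¹.mulVec x)) by ring, Real.exp_add,
    Real.exp_log hd]

open scoped MatrixOrder in
-- `S` is the positive square root of `K`, and it turns standard noise into a vector with covariance
-- `K`.
theorem exists_isUnit_mul_transpose [DecidableEq ι] {K : Matrix ι ι ℝ} (hK : K.PosDef) :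
    ∃ S : Matrix ι ι ℝ, IsUnit S ∧ S * S.transpose = K := by
  have h1 : CFC.sqrt K * CFC.sqrt K = K := CFC.sqrt_mul_sqrt_self K hK.posSemidef.nonneg
  have h2 : (CFC.sqrt K).transpose = CFC.sqrt K := by
    have := (CFC.sqrt_nonneg K).isSelfAdjoint
    rwa [IsSelfAdjoint, Matrix.star_eq_conjTranspose, Matrix.conjTranspose_eq_transpose_of_trivial]
      at this
  refine ⟨CFC.sqrt K, ?_, by rw [h2, h1]⟩
  have h3 := hK.isUnit
  rw [← h1] at h3
  rw [Matrix.isUnit_iff_isUnit_det] at h3 ⊢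
  rw [Matrix.det_mul] at h3
  exact isUnit_of_mul_isUnit_left h3

omit [Fintype ι] in
instance isGaussian_gaussianNoise [Finite ι] : IsGaussian (gaussianNoise ι) := by
  have hind : iIndepFun (fun (t : ι) (z : ι → ℝ) => z t) (gaussianNoise ι) :=
    iIndepFun_infinitePi (P := fun _ => gaussianReal 0 1) (X := fun _ => id) fun _ => measurable_id
  have := (iIndepFun.hasGaussianLaw
    (fun i => (isGaussianProcess_gaussianNoise ι).hasGaussianLaw_eval i) hind).isGaussian_map
  rwa [show (fun (z : ι → ℝ) i => z i) = id from rfl, Measure.map_id] at this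

/-- The density of a nondegenerate centered Gaussian law. -/
theorem gaussian_eq_densityLaw [DecidableEq ι] {K : Matrix ι ι ℝ} (hK : K.PosDef)
    (μ : Measure (ι → ℝ)) [IsGaussian μ] (hmean : ∀ i, ∫ x, x i ∂μ = 0)
    (hcov : ∀ i j, cov[fun x : ι → ℝ => x i, fun x => x j; μ] = K i j) :
    ∃ κ : ℝ, μ = densityLaw fun x => Real.exp (-κ - (x ⬝ᵥ K⁻¹.mulVec x) / 2) := by
  obtain ⟨S, hSu, hS⟩ := exists_isUnit_mul_transpose hK
  obtain ⟨κ, hκ⟩ := pi_gaussianReal_eq_densityLaw (ι := ι)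
  obtain ⟨κ', hκ'⟩ := densityLaw_map_linear S hSu κ (fun z => (z ⬝ᵥ z) / 2)
    (by unfold dotProduct; fun_prop)
  refine ⟨κ', ?_⟩
  have hquad : ∀ x, S⁻¹.mulVec x ⬝ᵥ S⁻¹.mulVec x = x ⬝ᵥ K⁻¹.mulVec x := fun x => by
    rw [← hS, Matrix.mul_inv_rev, ← Matrix.mulVec_mulVec, Matrix.dotProduct_mulVec x,
      ← Matrix.transpose_nonsing_inv, Matrix.vecMul_transpose]
  simp only [hquad] at hκ'
  rw [← hκ', ← hκ]
  have hmeas : Measurable (Matrix.toLin' S) := (LinearMap.continuous_on_pi _).measurable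
  rw [← Measure.infinitePi_eq_pi]
  have : IsGaussian ((gaussianNoise ι).map (Matrix.toLin' S)) := by
    have : IsGaussian ((gaussianNoise ι).map (LinearMap.toContinuousLinearMap (Matrix.toLin' S))) := inferInstance
    exact this
  refine gaussian_ext (fun i => ?_) fun i j => ?_
  · rw [hmean, integral_map hmeas.aemeasurable (measurable_pi_apply i).aestronglyMeasurable]
    simp only [Matrix.toLin'_apply, Matrix.mulVec, dotProduct]
    rw [integral_finsetSum _ fun k _ => ((memLp_gaussianNoise k).integrable (by norm_num)).const_mul _]
    simp [integral_const_mul, integral_gaussianNoise]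
  · rw [hcov, covariance_map (measurable_pi_apply i).aestronglyMeasurable
      (measurable_pi_apply j).aestronglyMeasurable hmeas.aemeasurable]
    simp only [Function.comp_def, Matrix.toLin'_apply, Matrix.mulVec, dotProduct]
    rw [covariance_fun_sum_fun_sum (fun k => (memLp_gaussianNoise k).const_mul _) (fun k => (memLp_gaussianNoise k).const_mul _)]
    simp only [covariance_const_mul_left, covariance_const_mul_right, covariance_gaussianNoise]
    rw [← hS]
    simp [Matrix.mul_apply, mul_comm]

end Gaussian

/-! ### Existence of the Gaussian processes -/

/-- A Cholesky factorization of an infinite positive definite matrix. -/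
theorem exists_cholesky {P : Matrix ℕ+ ℕ+ ℝ} (hP : P.PosDef) :
    ∃ A : ℕ+ → ℕ+ → ℝ, ∀ s t, ∑ r ∈ Finset.Iic s, ∑ r' ∈ Finset.Iic t,
      A s r * (A t r' * if r = r' then 1 else 0) = P s t := by
  have hsymm : ∀ i j, P i j = P j i := fun i j => by
    have := hP.isHermitian.apply j i
    simpa using this
  -- `P` is the Gram matrix of the unit vectors for the inner product it defines on finitely
  -- supported sequences. Gram–Schmidt is triangular, so each row of the factor is finite.
  let core : InnerProductSpace.Core ℝ (ℕ+ →₀ ℝ) :=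
    { inner := fun x y => x.sum fun i xi => y.sum fun j yj => xi * P i j * yj
      conj_inner_symm := fun x y => by
        simp only [conj_trivial]
        rw [Finsupp.sum_comm]
        exact Finsupp.sum_congr fun i _ => Finsupp.sum_congr fun j _ => by rw [hsymm j i]; ring
      re_inner_nonneg := fun x => by
        have := hP.posSemidef.2 x
        simpa using this
      add_left := fun x y z => by
        refine Finsupp.sum_add_index' (fun i => by simp) (fun i a b => ?_)
        simp [add_mul, Finsupp.sum_add]
      smul_left := fun x y r => by
        rw [Finsupp.sum_smul_index (fun i => by simp)]
        simp [Finsupp.mul_sum, mul_assoc]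
      definite := fun x hx => by
        by_contra h0
        have := hP.2 h0
        simp only [star_trivial] at this
        exact this.ne' hx }
  let _ : NormedAddCommGroup (ℕ+ →₀ ℝ) := core.toNormedAddCommGroup
  let _ : InnerProductSpace ℝ (ℕ+ →₀ ℝ) := InnerProductSpace.ofCore core.toCore
  let v : ℕ+ → (ℕ+ →₀ ℝ) := fun t => Finsupp.single t 1
  have hv : ∀ s t, inner ℝ (v s) (v t) = P s t := fun s t => by
    change ((Finsupp.single s (1 : ℝ)).sum fun i xi => (Finsupp.single t (1 : ℝ)).sum
      fun j yj => xi * P i j * yj) = P s t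
    simp
  let e := InnerProductSpace.gramSchmidt ℝ v
  let b : ℕ+ → ℕ+ → ℝ := fun t r => if r = t then 1 else inner ℝ (e r) (v t) / ‖e r‖ ^ 2
  have hvb : ∀ t, v t = ∑ r ∈ Finset.Iic t, b t r • e r := fun t => by
    rw [← Finset.Iio_insert, Finset.sum_insert (by simp)]
    have h1 := InnerProductSpace.gramSchmidt_def'' ℝ v t
    rw [h1]
    congr 1
    · simp [b, e]
    · refine Finset.sum_congr rfl fun r hr => ?_
      simp [b, e, (Finset.mem_Iio.1 hr).ne]
  -- The Gram–Schmidt vectors are orthogonal but not normalized; `‖e r‖` makes up for it.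
  refine ⟨fun t r => b t r * ‖e r‖, fun s t => ?_⟩
  rw [← hv, hvb s, hvb t, sum_inner]
  refine Finset.sum_congr rfl fun r _ => ?_
  rw [inner_sum]
  refine Finset.sum_congr rfl fun r' _ => ?_
  rw [real_inner_smul_left, real_inner_smul_right]
  split_ifs with h
  · subst h
    rw [real_inner_self_eq_norm_sq]
    ring
  · rw [InnerProductSpace.gramSchmidt_orthogonal ℝ v h]
    ring

/-- The law of a process obtained from independent standard Gaussians by finite linear
combinations. -/
theorem exists_gaussianLaw_of_sum {T U : Type*} [DecidableEq U] (F : T → Finset ℕ+)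
    (e : T → ℕ+ → U) (A : T → ℕ+ → ℝ) (K : Matrix T T ℝ)
    (hK : ∀ s t, ∑ r ∈ F s, ∑ r' ∈ F t, A s r * (A t r' * if e s r = e t r' then 1 else 0) = K s t) :
    ∃ μ : ProbabilityMeasure (T → ℝ), IsZeroMeanGaussianLaw K μ := by
  set m := gaussianNoise U with hm
  have hG := isGaussianProcess_gaussianNoise U
  rw [← hm] at hG
  set Z : T → (U → ℝ) → ℝ := fun t z => ∑ r ∈ F t, A t r * z (e t r) with hZ
  have hZG : IsGaussianProcess Z m := hG.of_isGaussianProcess fun t => by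
    refine ⟨(F t).image (e t), ∑ r ∈ (F t).attach, A t r • ContinuousLinearMap.proj
      (⟨e t r, Finset.mem_image_of_mem _ r.2⟩ : (F t).image (e t)), fun z => ?_⟩
    simp only [hZ, _root_.sum_apply, _root_.smul_apply,
      ContinuousLinearMap.proj_apply, Finset.restrict, smul_eq_mul]
    exact (Finset.sum_attach (F t) fun r => A t r * z (e t r)).symm
  have hmeas : Measurable fun (z : U → ℝ) (t : T) => Z t z := by
    refine measurable_pi_lambda _ fun t => ?_
    simp only [hZ]
    fun_prop
  refine ⟨⟨m.map fun z t => Z t z, Measure.isProbabilityMeasure_map hmeas.aemeasurable⟩, ?_, ?_, ?_⟩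
  · refine ⟨fun I => ⟨?_⟩⟩
    change IsGaussian (Measure.map _ (Measure.map _ _))
    rw [Measure.map_map (by fun_prop) hmeas]
    exact (hZG.hasGaussianLaw I).isGaussian_map
  · intro t
    change ∫ θ : T → ℝ, θ t ∂(m.map fun z t => Z t z) = 0
    rw [integral_map hmeas.aemeasurable (measurable_pi_apply t).aestronglyMeasurable]
    simp only [hZ]
    rw [integral_finsetSum _ fun k _ => ((memLp_gaussianNoise _).integrable (by norm_num)).const_mul _]
    simp [integral_const_mul, integral_gaussianNoise]
  · intro s t
    change cov[_, _; m.map fun z t => Z t z] = _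
    rw [covariance_map (measurable_pi_apply s).aestronglyMeasurable
      (measurable_pi_apply t).aestronglyMeasurable hmeas.aemeasurable, ← hK]
    simp only [Function.comp_def, hZ]
    rw [covariance_fun_sum_fun_sum' (fun k _ => (memLp_gaussianNoise _).const_mul _) (fun k _ => (memLp_gaussianNoise _).const_mul _)]
    simp only [covariance_const_mul_left, covariance_const_mul_right, covariance_gaussianNoise]
    exact Finset.sum_congr rfl fun _ _ => Finset.sum_congr rfl fun _ _ => mul_left_comm _ _ _

/-- Rescaling the coordinates of a process. -/
noncomputable def scaleLaw {T : Type*} (w : T → ℝ) (μ : ProbabilityMeasure (T → ℝ)) :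
    ProbabilityMeasure (T → ℝ) :=
  μ.map (f := fun θ t => w t * θ t)
    (measurable_pi_lambda _ fun t => (measurable_pi_apply t).const_mul (w t)).aemeasurable

theorem IsZeroMeanGaussianLaw.scaleLaw {T : Type*} {K K' : Matrix T T ℝ}
    {μ : ProbabilityMeasure (T → ℝ)} (h : IsZeroMeanGaussianLaw K μ) (w : T → ℝ)
    (hK : ∀ s t, K' s t = w s * (w t * K s t)) : IsZeroMeanGaussianLaw K' (scaleLaw w μ) := by
  have hmeas : Measurable fun (θ : T → ℝ) t => w t * θ t := by
    fun_prop
  have hmap : ((KroneckerMaxEnt.scaleLaw w μ : ProbabilityMeasure (T → ℝ)) : Measure (T → ℝ)) =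
    (μ : Measure (T → ℝ)).map fun θ t => w t * θ t := rfl
  refine ⟨⟨fun I => ⟨?_⟩⟩, fun t => ?_, fun s t => ?_⟩
  · rw [hmap, Measure.map_map (by fun_prop) hmeas]
    exact ((h.gaussian.smul w).hasGaussianLaw I).isGaussian_map
  · rw [hmap, integral_map hmeas.aemeasurable (measurable_pi_apply t).aestronglyMeasurable, integral_const_mul, h.mean_zero,
      mul_zero]
  · rw [hmap, covariance_map (measurable_pi_apply s).aestronglyMeasurable
      (measurable_pi_apply t).aestronglyMeasurable hmeas.aemeasurable, hK, ← h.cov_eq]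
    simp only [Function.comp_def, covariance_const_mul_left, covariance_const_mul_right]
    exact mul_left_comm _ _ _

variable {p₁ p₂ m : ℕ}

/-- The process with unit gains. -/
theorem exists_unit_process {P R : Matrix ℕ+ ℕ+ ℝ} (hP : P.PosDef) (hR : R.PosDef) :
    ∃ μ : ProbabilityMeasure (PathIdx p₁ p₂ m → ℝ), IsZeroMeanGaussianLaw
      (Matrix.fromBlocks ((1 : Matrix (GBlock p₁ p₂) (GBlock p₁ p₂) ℝ) ⊗ₖ P) 0 0
        ((1 : Matrix (FBlock p₁ p₂ m) (FBlock p₁ p₂ m) ℝ) ⊗ₖ R)) μ := by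
  obtain ⟨A, hA⟩ := exists_cholesky hP
  obtain ⟨B, hB⟩ := exists_cholesky hR
  -- Each block has its own copy of the noise, which makes distinct blocks uncorrelated.
  refine exists_gaussianLaw_of_sum (U := PathIdx p₁ p₂ m)
    (Sum.elim (fun x => Finset.Iic x.2) (fun x => Finset.Iic x.2))
    (Sum.elim (fun x r => .inl (x.1, r)) (fun x r => .inr (x.1, r)))
    (Sum.elim (fun x => A x.2) (fun x => B x.2)) _ ?_
  rintro (⟨s, i⟩ | ⟨s, i⟩) (⟨t, j⟩ | ⟨t, j⟩)
  · by_cases h : s = t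
    · subst h
      simpa using hA i j
    · simp [h]
  · simp
  · simp
  · by_cases h : s = t
    · subst h
      simpa using hB i j
    · simp [h]

/-! ### Gibbs' inequality -/

section Gibbs

theorem integrable_of_lintegral_ofReal_ne_top {α : Type*} [MeasurableSpace α] {μ : Measure α}
    {f : α → ℝ} (hf : Measurable f) (h0 : ∀ x, 0 ≤ f x) (h : ∫⁻ x, ENNReal.ofReal (f x) ∂μ ≠ ⊤) :
    Integrable f μ :=
  ⟨hf.aestronglyMeasurable, (hasFiniteIntegral_iff_ofReal (ae_of_all _ h0)).2 h.lt_top⟩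

variable {ι : Type*} [Fintype ι]

theorem entropy_eq_integral {q : (ι → ℝ) → ℝ}
    (h : Integrable fun x => Real.negMulLog (q x)) :
    entropy q = ((∫ x, Real.negMulLog (q x) : ℝ) : EReal) := by
  have h1 : ∫⁻ x, ENNReal.ofReal (Real.negMulLog (q x)) ≠ ⊤ := h.lintegral_lt_top.ne
  have h2 : ∫⁻ x, ENNReal.ofReal (-Real.negMulLog (q x)) ≠ ⊤ := h.neg.lintegral_lt_top.ne
  rw [integral_eq_lintegral_pos_part_sub_lintegral_neg_part h, EReal.coe_sub,
    EReal.coe_ennreal_toReal h1, EReal.coe_ennreal_toReal h2]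
  rfl

theorem lintegral_densityLaw {q : (ι → ℝ) → ℝ} (hq : Measurable q) (h0 : ∀ x, 0 ≤ q x)
    {Q : (ι → ℝ) → ℝ} (hQ : Measurable Q) :
    ∫⁻ x, ENNReal.ofReal (Q x) ∂(densityLaw q) = ∫⁻ x, ENNReal.ofReal (q x * Q x) := by
  rw [densityLaw, lintegral_withDensity_eq_lintegral_mul _ hq.ennreal_ofReal hQ.ennreal_ofReal]
  exact lintegral_congr fun x => (ENNReal.ofReal_mul (h0 x)).symm

theorem integrable_and_integral_mul {q : (ι → ℝ) → ℝ} (hq : Measurable q) (h0 : ∀ x, 0 ≤ q x)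
    {Q : (ι → ℝ) → ℝ} (hQ : Measurable Q) (hQ0 : ∀ x, 0 ≤ Q x) {N : ℝ} (hN : 0 ≤ N)
    (hE : ∫⁻ x, ENNReal.ofReal (Q x) ∂(densityLaw q) ≤ ENNReal.ofReal N) :
    Integrable (fun x => q x * Q x) ∧ ∫ x, q x * Q x ≤ N := by
  rw [lintegral_densityLaw hq h0 hQ] at hE
  have hnn : ∀ x, 0 ≤ q x * Q x := fun x => mul_nonneg (h0 x) (hQ0 x)
  refine ⟨integrable_of_lintegral_ofReal_ne_top (hq.mul hQ) hnn
    (hE.trans_lt ENNReal.ofReal_lt_top).ne, ?_⟩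
  rw [integral_eq_lintegral_of_nonneg_ae (ae_of_all _ hnn) (hq.mul hQ).aestronglyMeasurable]
  exact ENNReal.toReal_le_of_le_ofReal hN hE

theorem IsPosBddDensity.integrable {q : (ι → ℝ) → ℝ} (hq : IsPosBddDensity q) :
    Integrable q ∧ ∫ x, q x = 1 := by
  refine ⟨integrable_of_lintegral_ofReal_ne_top hq.measurable (fun x => (hq.pos x).le)
    (by simp [hq.lintegral_eq_one]), ?_⟩
  rw [integral_eq_lintegral_of_nonneg_ae (ae_of_all _ fun x => (hq.pos x).le)
    hq.measurable.aestronglyMeasurable, hq.lintegral_eq_one, ENNReal.toReal_one]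

/-- This is `x - 1 - log x ≥ 0`, with equality only at `x = 1`, for `x = exp (-L) / q`. The terms
`exp (-L) - q` integrate to zero for two probability densities and make the integrand of the
relative entropy nonnegative pointwise. -/
theorem log_div_nonneg_gap {q L : ℝ} (hq : 0 < q) :
    0 ≤ q * L + Real.exp (-L) - q - Real.negMulLog q ∧
      (q * L + Real.exp (-L) - q - Real.negMulLog q = 0 → q = Real.exp (-L)) := by
  have hr : 0 < Real.exp (-L) / q := by positivity
  have hlog : Real.log (Real.exp (-L) / q) = -L - Real.log q := by
    rw [Real.log_div (Real.exp_pos _).ne' hq.ne', Real.log_exp]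
  have hid : q * L + Real.exp (-L) - q - Real.negMulLog q =
      q * (Real.exp (-L) / q - 1 - Real.log (Real.exp (-L) / q)) := by
    rw [hlog, Real.negMulLog]
    field_simp
    ring
  rw [hid]
  refine ⟨mul_nonneg hq.le (by linarith [Real.log_le_sub_one_of_pos hr]), fun h => ?_⟩
  by_contra hne
  have h1 : Real.exp (-L) / q ≠ 1 := fun h1 => hne (by
    rw [div_eq_one_iff_eq hq.ne'] at h1; exact h1.symm)
  have h2 := Real.log_lt_sub_one_of_pos hr h1
  rcases mul_eq_zero.1 h with h3 | h3 <;> linarith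

variable {Q : (ι → ℝ) → ℝ} {κ N : ℝ}

/-- Among the densities with `E Q ≤ N`, the entropy is bounded by that of `exp (-κ - Q / 2)`, with
equality only for this density. -/
theorem entropy_le_of_lintegral_le (hQ : Measurable Q) (hQ0 : ∀ x, 0 ≤ Q x)
    (hp : IsPosBddDensity fun x => Real.exp (-κ - Q x / 2)) (hN : 0 ≤ N)
    {q : (ι → ℝ) → ℝ} (hq : IsPosBddDensity q)
    (hE : ∫⁻ x, ENNReal.ofReal (Q x) ∂(densityLaw q) ≤ ENNReal.ofReal N) :
    entropy q ≤ ((κ + N / 2 : ℝ) : EReal) ∧ (((κ + N / 2 : ℝ) : EReal) ≤ entropy q →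
      densityLaw q = densityLaw fun x => Real.exp (-κ - Q x / 2)) := by
  obtain ⟨hqi, hq1⟩ := hq.integrable
  obtain ⟨hpi, hp1⟩ := hp.integrable
  obtain ⟨hqQ, hqQN⟩ := integrable_and_integral_mul hq.measurable (fun x => (hq.pos x).le) hQ hQ0 hN hE
  have hexp : ∀ x, Real.exp (-κ - Q x / 2) = Real.exp (-(κ + Q x / 2)) := fun x => by
    congr 1; ring
  simp only [hexp] at hpi hp1 ⊢
  have hqL : Integrable fun x => q x * (κ + Q x / 2) := by
    have := (hqi.mul_const κ).add (hqQ.div_const 2)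
    refine this.congr (ae_of_all _ fun x => ?_)
    simp only [Pi.add_apply]
    ring
  have hqL1 : ∫ x, q x * (κ + Q x / 2) = κ + (∫ x, q x * Q x) / 2 := by
    calc ∫ x, q x * (κ + Q x / 2) = ∫ x, (q x * κ + q x * Q x / 2) :=
          integral_congr_ae (ae_of_all _ fun x => by ring)
      _ = κ + (∫ x, q x * Q x) / 2 := by
        rw [integral_add (hqi.mul_const κ) (hqQ.div_const 2), integral_mul_const, integral_div, hq1,
          one_mul]
  have hU : Integrable fun x => q x * (κ + Q x / 2) + Real.exp (-(κ + Q x / 2)) - q x :=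
    (hqL.add hpi).sub hqi
  obtain ⟨M, hM⟩ := hq.bounded
  -- From above the gap inequality gives an integrable bound; from below `q ≤ M` gives `-q * |log
  -- M|`.
  have hnml : Integrable fun x => Real.negMulLog (q x) := by
    refine (hU.abs.add (hqi.mul_const |Real.log M|)).mono'
      (Real.continuous_negMulLog.measurable.comp hq.measurable).aestronglyMeasurable
      (ae_of_all _ fun x => ?_)
    have h1 := (log_div_nonneg_gap (L := κ + Q x / 2) (hq.pos x)).1
    have h2 : q x * Real.log (q x) ≤ q x * |Real.log M| :=
      mul_le_mul_of_nonneg_left ((Real.log_le_log (hq.pos x) (hM x)).trans (le_abs_self _))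
        (hq.pos x).le
    have h3 : -Real.negMulLog (q x) = q x * Real.log (q x) := by rw [Real.negMulLog]; ring
    have h4 : 0 ≤ q x * |Real.log M| := mul_nonneg (hq.pos x).le (abs_nonneg _)
    have h5 := le_abs_self (q x * (κ + Q x / 2) + Real.exp (-(κ + Q x / 2)) - q x)
    have h6 := abs_nonneg (q x * (κ + Q x / 2) + Real.exp (-(κ + Q x / 2)) - q x)
    rw [Real.norm_eq_abs, abs_le]
    simp only [Pi.add_apply]
    constructor <;> linarith
  have hgap := fun x => log_div_nonneg_gap (L := κ + Q x / 2) (hq.pos x)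
  have hD : ∫ x, (q x * (κ + Q x / 2) + Real.exp (-(κ + Q x / 2)) - q x - Real.negMulLog (q x)) =
      κ + (∫ x, q x * Q x) / 2 - ∫ x, Real.negMulLog (q x) := by
    rw [integral_sub hU hnml, integral_sub (f := fun x => _ + _) (hqL.add hpi) hqi,
      integral_add hqL hpi, hqL1, hp1, hq1]
    ring
  have hD0 : 0 ≤ ∫ x, (q x * (κ + Q x / 2) + Real.exp (-(κ + Q x / 2)) - q x -
      Real.negMulLog (q x)) := integral_nonneg fun x => (hgap x).1
  rw [entropy_eq_integral hnml, EReal.coe_le_coe_iff, EReal.coe_le_coe_iff]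
  refine ⟨by linarith, fun hge => ?_⟩
  -- If the entropy reaches the bound, the nonnegative gap has integral zero and vanishes almost
  -- everywhere.
  have hzero := (integral_eq_zero_iff_of_nonneg (fun x => (hgap x).1) (hU.sub hnml)).1
    (le_antisymm (by linarith) hD0)
  refine withDensity_congr_ae ?_
  filter_upwards [hzero] with x hx
  rw [← (hgap x).2 hx]

/-- Here `-log p = κ + Q / 2`, so the Gibbs bound is attained. -/
theorem entropy_exp_eq (hQ : Measurable Q) (hQ0 : ∀ x, 0 ≤ Q x)
    (hp : IsPosBddDensity fun x => Real.exp (-κ - Q x / 2)) (hN : 0 ≤ N)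
    (hE : ∫⁻ x, ENNReal.ofReal (Q x) ∂(densityLaw fun x => Real.exp (-κ - Q x / 2)) =
      ENNReal.ofReal N) :
    entropy (fun x => Real.exp (-κ - Q x / 2)) = ((κ + N / 2 : ℝ) : EReal) := by
  obtain ⟨hpi, hp1⟩ := hp.integrable
  obtain ⟨hpQ, -⟩ := integrable_and_integral_mul hp.measurable (fun x => (hp.pos x).le) hQ hQ0 hN hE.le
  have hint : ∫ x, Real.exp (-κ - Q x / 2) * Q x = N := by
    rw [integral_eq_lintegral_of_nonneg_ae
      (ae_of_all _ fun x => mul_nonneg (hp.pos x).le (hQ0 x))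
      (hp.measurable.mul hQ).aestronglyMeasurable,
      ← lintegral_densityLaw hp.measurable (fun x => (hp.pos x).le) hQ, hE, ENNReal.toReal_ofReal hN]
  have hnml : (fun x => Real.negMulLog (Real.exp (-κ - Q x / 2))) =
      fun x => Real.exp (-κ - Q x / 2) * κ + Real.exp (-κ - Q x / 2) * Q x / 2 := by
    funext x
    rw [Real.negMulLog, Real.log_exp]
    ring
  have hi : Integrable fun x => Real.negMulLog (Real.exp (-κ - Q x / 2)) := by
    rw [hnml]
    exact (hpi.mul_const κ).add (hpQ.div_const 2)
  rw [entropy_eq_integral hi, hnml, integral_add (hpi.mul_const κ) (hpQ.div_const 2),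
    integral_mul_const, integral_div, hint, hp1, one_mul]

end Gibbs

/-! ### The finite sections of the kernel -/

section Kernel

theorem posDef_fromBlocks {α β : Type*} [Fintype α] [Fintype β] [DecidableEq α] [DecidableEq β]
    {A : Matrix α α ℝ} {B : Matrix β β ℝ} (hA : A.PosDef) (hB : B.PosDef) :
    (Matrix.fromBlocks A 0 0 B).PosDef := by
  refine Matrix.PosDef.of_dotProduct_mulVec_pos ?_ fun x hx => ?_
  · exact Matrix.IsHermitian.fromBlocks hA.isHermitian (by simp) hB.isHermitian
  · have hsplit : star x ⬝ᵥ (Matrix.fromBlocks A 0 0 B).mulVec x =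
        star (x ∘ Sum.inl) ⬝ᵥ A.mulVec (x ∘ Sum.inl) + star (x ∘ Sum.inr) ⬝ᵥ B.mulVec (x ∘ Sum.inr) := by
      rw [Matrix.fromBlocks_mulVec]
      simp only [dotProduct, Fintype.sum_sum_type, Matrix.zero_mulVec, add_zero, zero_add,
        Sum.elim_inl, Sum.elim_inr]
      rfl
    rw [hsplit]
    by_cases h : x ∘ Sum.inl = 0
    · have h' : x ∘ Sum.inr ≠ 0 := fun h' => hx (by
        funext i
        rcases i with i | i
        exacts [congrFun h i, congrFun h' i])
      exact add_pos_of_nonneg_of_pos (by simp [h]) (hB.dotProduct_mulVec_pos h')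
    · exact add_pos_of_pos_of_nonneg (hA.dotProduct_mulVec_pos h)
        (hB.posSemidef.dotProduct_mulVec_nonneg _)

/-- Quadratic form of a block diagonal kernel. -/
theorem dotProduct_diagonal_kronecker {α τ : Type*} [Fintype α] [Fintype τ] [DecidableEq α]
    [DecidableEq τ] (d : α → ℝ) (B : Matrix τ τ ℝ) (v : α × τ → ℝ) :
    v ⬝ᵥ (Matrix.diagonal d ⊗ₖ B).mulVec v =
      ∑ s, d s * ((fun t => v (s, t)) ⬝ᵥ B.mulVec fun t => v (s, t)) := by
  simp only [dotProduct, Matrix.mulVec, Fintype.sum_prod_type, Matrix.kroneckerMap_apply,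
    Finset.mul_sum]
  refine Finset.sum_congr rfl fun s _ => Finset.sum_congr rfl fun t _ => ?_
  rw [Finset.sum_eq_single s]
  · refine Finset.sum_congr rfl fun t' _ => ?_
    rw [Matrix.diagonal_apply_eq]
    ring
  · intro s' _ hs'
    simp [Matrix.diagonal_apply_ne _ (Ne.symm hs')]
  · simp

theorem inv_fromBlocks_diagonal_kronecker {α β τ υ : Type*} [Fintype α] [Fintype β] [Fintype τ]
    [Fintype υ] [DecidableEq α] [DecidableEq β] [DecidableEq τ] [DecidableEq υ]
    {d : α → ℝ} {e : β → ℝ} (hd : ∀ a, 0 < d a) (he : ∀ b, 0 < e b)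
    {A : Matrix τ τ ℝ} {B : Matrix υ υ ℝ} (hA : A.PosDef) (hB : B.PosDef) :
    (Matrix.fromBlocks (Matrix.diagonal d ⊗ₖ A) 0 0 (Matrix.diagonal e ⊗ₖ B))⁻¹ =
      Matrix.fromBlocks (Matrix.diagonal (fun a => (d a)⁻¹) ⊗ₖ A⁻¹) 0 0
        (Matrix.diagonal (fun b => (e b)⁻¹) ⊗ₖ B⁻¹) := by
  apply Matrix.inv_eq_right_inv
  rw [Matrix.fromBlocks_multiply]
  have hA' := (Matrix.isUnit_iff_isUnit_det A).1 hA.isUnit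
  have hB' := (Matrix.isUnit_iff_isUnit_det B).1 hB.isUnit
  simp only [Matrix.mul_zero, Matrix.zero_mul, add_zero, zero_add, ← Matrix.mul_kronecker_mul,
    Matrix.diagonal_mul_diagonal, Matrix.mul_nonsing_inv _ hA', Matrix.mul_nonsing_inv _ hB',
    mul_inv_cancel₀ (hd _).ne', mul_inv_cancel₀ (he _).ne', Matrix.diagonal_one,
    Matrix.one_kronecker_one, Matrix.fromBlocks_one]

variable {p₁ p₂ m : ℕ}

instance instDecidableEqFinIdx {Ig If : Finset ℕ+} : DecidableEq (FinIdx p₁ p₂ m Ig If) :=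
  @instDecidableEqSum _ _ inferInstance inferInstance

/-- Covariance matrix of the finite vector extracted from a process with gains `X` and `Y`. -/
noncomputable def finKernel (P R : Matrix ℕ+ ℕ+ ℝ) (Ig If : Finset ℕ+) (X : GBlock p₁ p₂ → ℝ)
    (Y : FBlock p₁ p₂ m → ℝ) : Matrix (FinIdx p₁ p₂ m Ig If) (FinIdx p₁ p₂ m Ig If) ℝ :=
  Matrix.fromBlocks (Matrix.diagonal X ⊗ₖ kernelMatrix P Ig) 0 0
    (Matrix.diagonal Y ⊗ₖ kernelMatrix R If)

/-- Weighted sum of the squared norms of the components of the extracted vector. -/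
noncomputable def quadForm (P R : Matrix ℕ+ ℕ+ ℝ) (Ig If : Finset ℕ+) (X : GBlock p₁ p₂ → ℝ)
    (Y : FBlock p₁ p₂ m → ℝ) (x : FinIdx p₁ p₂ m Ig If → ℝ) : ℝ :=
  ∑ s, (X s)⁻¹ * sqNorm P Ig (fun t => x (.inl (s, t))) +
    ∑ s, (Y s)⁻¹ * sqNorm R If (fun t => x (.inr (s, t)))

theorem posDef_kernelMatrix {P : Matrix ℕ+ ℕ+ ℝ} (hP : P.PosDef) (I : Finset ℕ+) :
    (kernelMatrix P I).PosDef := hP.submatrix Subtype.val_injective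

theorem sqNorm_nonneg {P : Matrix ℕ+ ℕ+ ℝ} (hP : P.PosDef) (I : Finset ℕ+) (v : I → ℝ) :
    0 ≤ sqNorm P I v := by
  unfold sqNorm
  simpa using (posDef_kernelMatrix hP I).inv.posSemidef.dotProduct_mulVec_nonneg v

theorem measurable_sqNorm {Ω : Type*} [MeasurableSpace Ω] (P : Matrix ℕ+ ℕ+ ℝ) (I : Finset ℕ+)
    {f : Ω → I → ℝ} (hf : ∀ t, Measurable fun ω => f ω t) : Measurable fun ω => sqNorm P I (f ω) := by
  unfold sqNorm dotProduct Matrix.mulVec dotProduct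
  fun_prop

variable {P R : Matrix ℕ+ ℕ+ ℝ} {Ig If : Finset ℕ+} {X : GBlock p₁ p₂ → ℝ} {Y : FBlock p₁ p₂ m → ℝ}

theorem posDef_finKernel (hP : P.PosDef) (hR : R.PosDef) (hX : ∀ s, 0 < X s) (hY : ∀ s, 0 < Y s) :
    (finKernel P R Ig If X Y).PosDef :=
  posDef_fromBlocks ((Matrix.PosDef.diagonal hX).kronecker (posDef_kernelMatrix hP Ig))
    ((Matrix.PosDef.diagonal hY).kronecker (posDef_kernelMatrix hR If))

/-- Gains and kernel sections are inverted separately, so the Gaussian exponent is a weighted sum of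
exactly the energies that the constraints bound. -/
theorem dotProduct_inv_finKernel (hP : P.PosDef) (hR : R.PosDef) (hX : ∀ s, 0 < X s)
    (hY : ∀ s, 0 < Y s) (x : FinIdx p₁ p₂ m Ig If → ℝ) :
    x ⬝ᵥ (finKernel P R Ig If X Y)⁻¹.mulVec x = quadForm P R Ig If X Y x := by
  rw [finKernel, inv_fromBlocks_diagonal_kronecker hX hY (posDef_kernelMatrix hP Ig)
    (posDef_kernelMatrix hR If), Matrix.fromBlocks_mulVec]
  simp only [Matrix.zero_mulVec, add_zero, zero_add]
  have h : ∀ (a : GBlock p₁ p₂ × Ig → ℝ) (b : FBlock p₁ p₂ m × If → ℝ),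
      x ⬝ᵥ Sum.elim a b = (x ∘ Sum.inl) ⬝ᵥ a + (x ∘ Sum.inr) ⬝ᵥ b := fun a b => by
    simp [dotProduct, Fintype.sum_sum_type]
  rw [h, dotProduct_diagonal_kronecker, dotProduct_diagonal_kronecker]
  rfl

theorem quadForm_nonneg (hP : P.PosDef) (hR : R.PosDef) (hX : ∀ s, 0 < X s) (hY : ∀ s, 0 < Y s)
    (x : FinIdx p₁ p₂ m Ig If → ℝ) : 0 ≤ quadForm P R Ig If X Y x :=
  add_nonneg (Finset.sum_nonneg fun s _ => mul_nonneg (inv_nonneg.2 (hX s).le) (sqNorm_nonneg hP _ _))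
    (Finset.sum_nonneg fun s _ => mul_nonneg (inv_nonneg.2 (hY s).le) (sqNorm_nonneg hR _ _))

theorem measurable_sqNorm_inl (P : Matrix ℕ+ ℕ+ ℝ) (s : GBlock p₁ p₂) :
    Measurable fun x : FinIdx p₁ p₂ m Ig If → ℝ => sqNorm P Ig fun t => x (.inl (s, t)) :=
  measurable_sqNorm P Ig fun _ => measurable_pi_apply _

theorem measurable_sqNorm_inr (R : Matrix ℕ+ ℕ+ ℝ) (s : FBlock p₁ p₂ m) :
    Measurable fun x : FinIdx p₁ p₂ m Ig If → ℝ => sqNorm R If fun t => x (.inr (s, t)) :=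
  measurable_sqNorm R If fun _ => measurable_pi_apply _

theorem measurable_quadForm : Measurable (quadForm (p₁ := p₁) (p₂ := p₂) (m := m) P R Ig If X Y) := by
  unfold quadForm
  exact (Finset.measurable_fun_sum _ fun s _ => (measurable_sqNorm_inl P s).const_mul _).add
    (Finset.measurable_fun_sum _ fun s _ => (measurable_sqNorm_inr R s).const_mul _)

/-- The expectation of `‖v‖²` in the norm of `P_I⁻¹` for `v` with covariance `c P_I`. -/
theorem lintegral_sqNorm {Ω : Type*} [MeasurableSpace Ω] {μ : Measure Ω} [IsProbabilityMeasure μ]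
    {P : Matrix ℕ+ ℕ+ ℝ} (hP : P.PosDef) (I : Finset ℕ+) {v : I → Ω → ℝ} {c : ℝ}
    (hL : ∀ t, MemLp (v t) 2 μ)
    (hmean : ∀ t, ∫ ω, v t ω ∂μ = 0)
    (hcov : ∀ s t, cov[v s, v t; μ] = c * kernelMatrix P I s t) :
    ∫⁻ ω, ENNReal.ofReal (sqNorm P I fun t => v t ω) ∂μ = ENNReal.ofReal (I.card * c) := by
  have hint : ∀ s t, Integrable (fun ω => v s ω * ((kernelMatrix P I)⁻¹ s t * v t ω)) μ := fun s t =>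
    (((hL s).integrable_mul (hL t)).const_mul ((kernelMatrix P I)⁻¹ s t)).congr
      (ae_of_all _ fun ω => by simp only [Pi.mul_apply]; ring)
  have hE : ∀ s t, ∫ ω, v s ω * ((kernelMatrix P I)⁻¹ s t * v t ω) ∂μ =
      c * ((kernelMatrix P I)⁻¹ s t * kernelMatrix P I t s) := fun s t => by
    have h1 : ∫ ω, v s ω * v t ω ∂μ = c * kernelMatrix P I s t := by
      rw [← hcov, covariance_eq_sub (hL s) (hL t), hmean, zero_mul, sub_zero]
      rfl
    have h2 : kernelMatrix P I t s = kernelMatrix P I s t := by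
      simpa using (posDef_kernelMatrix hP I).isHermitian.apply s t
    rw [h2, mul_left_comm, ← h1, ← integral_const_mul]
    exact integral_congr_ae (ae_of_all _ fun ω => by ring)
  have hform : ∀ ω, sqNorm P I (fun t => v t ω) =
      ∑ s, ∑ t, v s ω * ((kernelMatrix P I)⁻¹ s t * v t ω) := fun ω => by
    simp only [sqNorm, dotProduct, Matrix.mulVec, Finset.mul_sum]
  rw [← ofReal_integral_eq_lintegral_ofReal _ (ae_of_all _ fun ω => sqNorm_nonneg hP I _)]
  · congr 1
    simp only [hform]
    rw [integral_finsetSum _ fun s _ => integrable_finsetSum _ fun t _ => hint s t]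
    have h3 : ∀ s, ∫ ω, ∑ t, v s ω * ((kernelMatrix P I)⁻¹ s t * v t ω) ∂μ =
        c * ∑ t, (kernelMatrix P I)⁻¹ s t * kernelMatrix P I t s := fun s => by
      rw [integral_finsetSum _ fun t _ => hint s t, Finset.mul_sum]
      exact Finset.sum_congr rfl fun t _ => hE s t
    rw [Finset.sum_congr rfl fun s _ => h3 s, ← Finset.mul_sum]
    -- The trace of the identity is the origin of the factor `|I|` in the scaled constants.
    have htr : ∑ s, ∑ t, (kernelMatrix P I)⁻¹ s t * kernelMatrix P I t s =
        ((kernelMatrix P I)⁻¹ * kernelMatrix P I).trace := by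
      simp [Matrix.trace, Matrix.mul_apply]
    rw [htr, Matrix.nonsing_inv_mul _ ((Matrix.isUnit_iff_isUnit_det _).1
      (posDef_kernelMatrix hP I).isUnit), Matrix.trace_one, Fintype.card_coe, mul_comm]
  · simp only [hform]
    exact integrable_finsetSum _ fun s _ => integrable_finsetSum _ fun t _ => hint s t

end Kernel

/-! ### Finite-dimensional laws of the processes -/

variable {p₁ p₂ m : ℕ}

section Marginal

theorem measurable_comp_incl {Ig If : Finset ℕ+} :
    Measurable fun (θ : PathIdx p₁ p₂ m → ℝ) (i : FinIdx p₁ p₂ m Ig If) => θ (FinIdx.incl i) :=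
  measurable_pi_lambda _ fun _ => measurable_pi_apply _

theorem coe_marginal (μ : ProbabilityMeasure (PathIdx p₁ p₂ m → ℝ)) (Ig If : Finset ℕ+) :
    (marginal μ Ig If : Measure (FinIdx p₁ p₂ m Ig If → ℝ)) =
      (μ : Measure (PathIdx p₁ p₂ m → ℝ)).map fun θ i => θ (FinIdx.incl i) := rfl

theorem IsZeroMeanGaussianLaw.isGaussian_marginal {K : Matrix (PathIdx p₁ p₂ m) (PathIdx p₁ p₂ m) ℝ}
    {μ : ProbabilityMeasure (PathIdx p₁ p₂ m → ℝ)} (h : IsZeroMeanGaussianLaw K μ)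
    (Ig If : Finset ℕ+) :
    IsGaussian (marginal μ Ig If : Measure (FinIdx p₁ p₂ m Ig If → ℝ)) := by
  rw [coe_marginal]
  exact (((h.gaussian.comp_right (FinIdx.incl (Ig := Ig) (If := If))).hasGaussianLaw
    Finset.univ).map (ContinuousLinearMap.pi fun i =>
      ContinuousLinearMap.proj (⟨i, Finset.mem_univ i⟩ :
        (Finset.univ : Finset (FinIdx p₁ p₂ m Ig If))))).isGaussian_map

theorem IsZeroMeanGaussianLaw.integral_marginal
    {K : Matrix (PathIdx p₁ p₂ m) (PathIdx p₁ p₂ m) ℝ}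
    {μ : ProbabilityMeasure (PathIdx p₁ p₂ m → ℝ)} (h : IsZeroMeanGaussianLaw K μ)
    {Ig If : Finset ℕ+} (i : FinIdx p₁ p₂ m Ig If) :
    ∫ x, x i ∂(marginal μ Ig If : Measure (FinIdx p₁ p₂ m Ig If → ℝ)) = 0 := by
  rw [coe_marginal, integral_map measurable_comp_incl.aemeasurable
    (measurable_pi_apply i).aestronglyMeasurable]
  exact h.mean_zero _

theorem IsZeroMeanGaussianLaw.covariance_marginal
    {K : Matrix (PathIdx p₁ p₂ m) (PathIdx p₁ p₂ m) ℝ}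
    {μ : ProbabilityMeasure (PathIdx p₁ p₂ m → ℝ)} (h : IsZeroMeanGaussianLaw K μ)
    {Ig If : Finset ℕ+} (i j : FinIdx p₁ p₂ m Ig If) :
    cov[fun x => x i, fun x => x j; (marginal μ Ig If : Measure (FinIdx p₁ p₂ m Ig If → ℝ))] =
      K i.incl j.incl := by
  rw [coe_marginal, covariance_map (measurable_pi_apply i).aestronglyMeasurable
    (measurable_pi_apply j).aestronglyMeasurable measurable_comp_incl.aemeasurable]
  exact h.cov_eq _ _

/-- The laws of the rescaled processes depend continuously on the scales. -/
theorem tendsto_marginal_scaleLaw {ι : Type*} {l : Filter ι} [l.IsCountablyGenerated]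
    (μ : ProbabilityMeasure (PathIdx p₁ p₂ m → ℝ)) (Ig If : Finset ℕ+)
    {w : ι → PathIdx p₁ p₂ m → ℝ} {w₀ : PathIdx p₁ p₂ m → ℝ}
    (hw : ∀ i : FinIdx p₁ p₂ m Ig If, Tendsto (fun n => w n i.incl) l (𝓝 (w₀ i.incl))) :
    Tendsto (fun n => marginal (scaleLaw (w n) μ) Ig If) l (𝓝 (marginal (scaleLaw w₀ μ) Ig If)) := by
  rw [ProbabilityMeasure.tendsto_iff_forall_integral_tendsto]
  intro f
  have hmeas : ∀ v : PathIdx p₁ p₂ m → ℝ, Measurable fun (θ : PathIdx p₁ p₂ m → ℝ) t => v t * θ t :=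
    fun v => by fun_prop
  have hmeas' : ∀ v : PathIdx p₁ p₂ m → ℝ, Measurable fun (θ : PathIdx p₁ p₂ m → ℝ)
      (i : FinIdx p₁ p₂ m Ig If) => v i.incl * θ i.incl := fun v => by fun_prop
  have hint : ∀ v : PathIdx p₁ p₂ m → ℝ,
      ∫ x, f x ∂(marginal (scaleLaw v μ) Ig If : Measure (FinIdx p₁ p₂ m Ig If → ℝ)) =
        ∫ θ, f (fun i => v i.incl * θ i.incl) ∂(μ : Measure (PathIdx p₁ p₂ m → ℝ)) := fun v => by
    have h1 : (marginal (scaleLaw v μ) Ig If : Measure (FinIdx p₁ p₂ m Ig If → ℝ)) =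
        (μ : Measure (PathIdx p₁ p₂ m → ℝ)).map fun θ i => v i.incl * θ i.incl := by
      rw [coe_marginal]
      change ((μ : Measure (PathIdx p₁ p₂ m → ℝ)).map fun θ t => v t * θ t).map _ = _
      rw [Measure.map_map measurable_comp_incl (hmeas v)]
      rfl
    rw [h1, integral_map (hmeas' v).aemeasurable f.continuous.aestronglyMeasurable]
  simp only [hint]
  -- All laws are images of the same `μ`, so weak convergence is dominated convergence along
  -- pointwise converging maps.
  refine tendsto_integral_filter_of_dominated_convergence (fun _ => ‖f‖)
    (Eventually.of_forall fun n => (f.continuous.measurable.comp (hmeas' _)).aestronglyMeasurable)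
    (Eventually.of_forall fun n => ae_of_all _ fun θ => f.norm_coe_le_norm _) (integrable_const _)
    (ae_of_all _ fun θ => ?_)
  exact (f.continuous.tendsto _).comp (tendsto_pi_nhds.2 fun i => (hw i).mul_const _)

end Marginal

/-! ### Solution of the maximum entropy problem -/

section MaxEnt

/-- Scales turning the process with unit gains into the process with gains `X` and `Y`. -/
noncomputable def gainScale (X : GBlock p₁ p₂ → ℝ) (Y : FBlock p₁ p₂ m → ℝ) :
    PathIdx p₁ p₂ m → ℝ :=
  Sum.elim (fun x => √(X x.1)) (fun x => √(Y x.1))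

variable {P R : Matrix ℕ+ ℕ+ ℝ} {X : GBlock p₁ p₂ → ℝ} {Y : FBlock p₁ p₂ m → ℝ}

/-- Kernel of the process with gains `X` and `Y`. -/
noncomputable def gainKernel (P R : Matrix ℕ+ ℕ+ ℝ) (X : GBlock p₁ p₂ → ℝ)
    (Y : FBlock p₁ p₂ m → ℝ) : Matrix (PathIdx p₁ p₂ m) (PathIdx p₁ p₂ m) ℝ :=
  Matrix.fromBlocks (Matrix.diagonal X ⊗ₖ P) 0 0 (Matrix.diagonal Y ⊗ₖ R)

theorem gainKernel_eq_scale (hX : ∀ s, 0 ≤ X s) (hY : ∀ s, 0 ≤ Y s) (s t : PathIdx p₁ p₂ m) :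
    gainKernel P R X Y s t = gainScale X Y s * (gainScale X Y t * Matrix.fromBlocks
      ((1 : Matrix (GBlock p₁ p₂) (GBlock p₁ p₂) ℝ) ⊗ₖ P) 0 0
        ((1 : Matrix (FBlock p₁ p₂ m) (FBlock p₁ p₂ m) ℝ) ⊗ₖ R) s t) := by
  rcases s with ⟨s, i⟩ | ⟨s, i⟩ <;> rcases t with ⟨t, j⟩ | ⟨t, j⟩
  · by_cases h : s = t
    · subst h
      simp only [gainKernel, gainScale, Matrix.fromBlocks_apply₁₁, Matrix.kroneckerMap_apply,
        Matrix.diagonal_apply_eq, Matrix.one_apply_eq, Sum.elim_inl, one_mul]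
      rw [← mul_assoc, Real.mul_self_sqrt (hX s)]
    · simp [gainKernel, h]
  · simp [gainKernel]
  · simp [gainKernel]
  · by_cases h : s = t
    · subst h
      simp only [gainKernel, gainScale, Matrix.fromBlocks_apply₂₂, Matrix.kroneckerMap_apply,
        Matrix.diagonal_apply_eq, Matrix.one_apply_eq, Sum.elim_inr, one_mul]
      rw [← mul_assoc, Real.mul_self_sqrt (hY s)]
    · simp [gainKernel, h]

theorem gainKernel_incl {Ig If : Finset ℕ+} (i j : FinIdx p₁ p₂ m Ig If) :
    gainKernel P R X Y i.incl j.incl = finKernel P R Ig If X Y i j := by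
  rcases i with ⟨s, i⟩ | ⟨s, i⟩ <;> rcases j with ⟨t, j⟩ | ⟨t, j⟩ <;> rfl

theorem gaussian_energies {Ig If : Finset ℕ+} {μ : ProbabilityMeasure (PathIdx p₁ p₂ m → ℝ)}
    (hP : P.PosDef) (hR : R.PosDef) (h : IsZeroMeanGaussianLaw (gainKernel P R X Y) μ) :
    (∀ s, ∫⁻ x, ENNReal.ofReal (sqNorm P Ig fun t => (x : FinIdx p₁ p₂ m Ig If → ℝ) (.inl (s, t)))
      ∂(marginal μ Ig If : Measure (FinIdx p₁ p₂ m Ig If → ℝ)) = ENNReal.ofReal (Ig.card * X s)) ∧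
    ∀ s, ∫⁻ x, ENNReal.ofReal (sqNorm R If fun t => (x : FinIdx p₁ p₂ m Ig If → ℝ) (.inr (s, t)))
      ∂(marginal μ Ig If : Measure (FinIdx p₁ p₂ m Ig If → ℝ)) = ENNReal.ofReal (If.card * Y s) := by
  have := h.isGaussian_marginal Ig If
  constructor
  · refine fun s => lintegral_sqNorm hP Ig (v := fun t (x : FinIdx p₁ p₂ m Ig If → ℝ) => x (.inl (s, t)))
      (fun t => memLp_two_eval _) (fun t => h.integral_marginal _) fun t t' => ?_
    rw [h.covariance_marginal, gainKernel_incl]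
    simp [finKernel]
  · refine fun s => lintegral_sqNorm hR If (v := fun t (x : FinIdx p₁ p₂ m Ig If → ℝ) => x (.inr (s, t)))
      (fun t => memLp_two_eval _) (fun t => h.integral_marginal _) fun t t' => ?_
    rw [h.covariance_marginal, gainKernel_incl]
    simp [finKernel]

/-- The finite-dimensional law with positive gains has an explicit positive bounded density. -/
theorem exists_marginal_density {μ : ProbabilityMeasure (PathIdx p₁ p₂ m → ℝ)}
    (hP : P.PosDef) (hR : R.PosDef) (hX : ∀ s, 0 < X s) (hY : ∀ s, 0 < Y s)
    (h : IsZeroMeanGaussianLaw (gainKernel P R X Y) μ) (Ig If : Finset ℕ+) :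
    ∃ κ : ℝ, IsPosBddDensity (fun x => Real.exp (-κ - quadForm P R Ig If X Y x / 2)) ∧
      (marginal μ Ig If : Measure (FinIdx p₁ p₂ m Ig If → ℝ)) =
        densityLaw fun x => Real.exp (-κ - quadForm P R Ig If X Y x / 2) := by
  have := h.isGaussian_marginal Ig If
  obtain ⟨κ, hκ⟩ := gaussian_eq_densityLaw (posDef_finKernel hP hR hX hY)
    (marginal μ Ig If : Measure (FinIdx p₁ p₂ m Ig If → ℝ))
    (fun i => h.integral_marginal i) fun i j => (h.covariance_marginal i j).trans (gainKernel_incl i j)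
  simp only [dotProduct_inv_finKernel hP hR hX hY] at hκ
  refine ⟨κ, ⟨?_, fun x => Real.exp_pos _, ⟨Real.exp (-κ), fun x => ?_⟩, ?_⟩, hκ⟩
  · exact Real.measurable_exp.comp ((measurable_quadForm.div_const 2).const_sub (-κ))
  · rw [Real.exp_le_exp]
    have := quadForm_nonneg (Ig := Ig) (If := If) hP hR hX hY x
    linarith
  · have h1 : densityLaw (fun x => Real.exp (-κ - quadForm P R Ig If X Y x / 2)) Set.univ = 1 := by
      rw [← hκ]
      exact measure_univ
    rwa [densityLaw, withDensity_apply _ MeasurableSet.univ, Measure.restrict_univ] at h1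

/-- Weighted energies under constraints on the row and column sums. -/
theorem IsBalanced.sum_ofReal_inv_mul_le {α β : Type*} [Fintype α] [Fintype β] {r : α → ℝ}
    {c : β → ℝ} {X : α × β → ℝ} (h : IsBalanced r c X) (hr : ∀ a, 0 < r a) (hc : ∀ b, 0 < c b)
    (n : ℕ) (E : α × β → ℝ≥0∞) (hrow : ∀ a, ∑ b, E (a, b) ≤ ENNReal.ofReal (n * r a))
    (hcol : ∀ b, ∑ a, E (a, b) ≤ ENNReal.ofReal (n * c b)) :
    ∑ j, ENNReal.ofReal (X j)⁻¹ * E j ≤ ENNReal.ofReal (n * Fintype.card (α × β)) := by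
  obtain ⟨μ, ν, hμ, hν, hsum, hZ⟩ := h.sum_div_le
  have hfin : ∀ j, E j ≠ ⊤ := fun j => by
    refine ((Finset.single_le_sum (f := fun b => E (j.1, b)) (fun _ _ => zero_le)
      (Finset.mem_univ j.2)).trans (hrow j.1)).trans_lt ENNReal.ofReal_lt_top |>.ne
  have hX : ∀ j, 0 < X j := fun j => h.pos (hr j.1) (hc j.2)
  have hrow' : ∀ a, ∑ b, (E (a, b)).toReal ≤ n * r a := fun a => by
    rw [← ENNReal.toReal_sum fun b _ => hfin _]
    exact ENNReal.toReal_le_of_le_ofReal (mul_nonneg n.cast_nonneg (hr a).le) (hrow a)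
  have hcol' : ∀ b, ∑ a, (E (a, b)).toReal ≤ n * c b := fun b => by
    rw [← ENNReal.toReal_sum fun a _ => hfin _]
    exact ENNReal.toReal_le_of_le_ofReal (mul_nonneg n.cast_nonneg (hc b).le) (hcol b)
  have h1 := hZ (fun j => (E j).toReal) fun j => ENNReal.toReal_nonneg
  simp only [hr, hc, and_self, if_true] at h1 hsum
  have h2 : ∑ a, μ a * ∑ b, (E (a, b)).toReal + ∑ b, ν b * ∑ a, (E (a, b)).toReal ≤
      ∑ a, μ a * (n * r a) + ∑ b, ν b * (n * c b) := by
    gcongr with a _ b _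
    exacts [hμ a, hrow' a, hν b, hcol' b]
  have h3 : ∑ a, μ a * (n * r a) + ∑ b, ν b * (n * c b) = n * Fintype.card (α × β) := by
    have h4 : ∑ a, μ a * (n * r a) + ∑ b, ν b * (n * c b) =
        n * (∑ a, μ a * r a + ∑ b, ν b * c b) := by
      rw [mul_add, Finset.mul_sum, Finset.mul_sum]
      congr 1 <;> exact Finset.sum_congr rfl fun _ _ => by ring
    rw [h4, hsum]
    simp [Fintype.card_prod]
  have h5 : ∑ j, ENNReal.ofReal (X j)⁻¹ * E j = ENNReal.ofReal (∑ j, (E j).toReal / X j) := by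
    rw [ENNReal.ofReal_sum_of_nonneg fun j _ => div_nonneg ENNReal.toReal_nonneg (hX j).le]
    refine Finset.sum_congr rfl fun j _ => ?_
    rw [div_eq_inv_mul, ENNReal.ofReal_mul (inv_nonneg.2 (hX j).le), ENNReal.ofReal_toReal (hfin j)]
  rw [h5]
  exact ENNReal.ofReal_le_ofReal ((h1.trans h2).trans_eq h3)

theorem lintegral_quadForm {Ig If : Finset ℕ+} (hP : P.PosDef) (hR : R.PosDef) (hX : ∀ s, 0 < X s)
    (hY : ∀ s, 0 < Y s) (μ : Measure (FinIdx p₁ p₂ m Ig If → ℝ)) :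
    ∫⁻ x, ENNReal.ofReal (quadForm P R Ig If X Y x) ∂μ =
      ∑ s, ENNReal.ofReal (X s)⁻¹ * ∫⁻ x, ENNReal.ofReal (sqNorm P Ig fun t => x (.inl (s, t))) ∂μ +
      ∑ s, ENNReal.ofReal (Y s)⁻¹ * ∫⁻ x, ENNReal.ofReal (sqNorm R If fun t => x (.inr (s, t))) ∂μ := by
  have hg : ∀ s, Measurable fun x : FinIdx p₁ p₂ m Ig If → ℝ =>
      ENNReal.ofReal (sqNorm P Ig fun t => x (.inl (s, t))) := fun s =>
    (measurable_sqNorm_inl P s).ennreal_ofReal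
  have hf : ∀ s, Measurable fun x : FinIdx p₁ p₂ m Ig If → ℝ =>
      ENNReal.ofReal (sqNorm R If fun t => x (.inr (s, t))) := fun s =>
    (measurable_sqNorm_inr R s).ennreal_ofReal
  have h1 : ∀ x : FinIdx p₁ p₂ m Ig If → ℝ, ENNReal.ofReal (quadForm P R Ig If X Y x) =
      ∑ s, ENNReal.ofReal (X s)⁻¹ * ENNReal.ofReal (sqNorm P Ig fun t => x (.inl (s, t))) +
      ∑ s, ENNReal.ofReal (Y s)⁻¹ * ENNReal.ofReal (sqNorm R If fun t => x (.inr (s, t))) := by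
    intro x
    have hx : ∀ s, 0 ≤ (X s)⁻¹ * sqNorm P Ig fun t => x (.inl (s, t)) := fun s =>
      mul_nonneg (inv_nonneg.2 (hX s).le) (sqNorm_nonneg hP _ _)
    have hy : ∀ s, 0 ≤ (Y s)⁻¹ * sqNorm R If fun t => x (.inr (s, t)) := fun s =>
      mul_nonneg (inv_nonneg.2 (hY s).le) (sqNorm_nonneg hR _ _)
    rw [quadForm, ENNReal.ofReal_add (Finset.sum_nonneg fun s _ => hx s)
      (Finset.sum_nonneg fun s _ => hy s), ENNReal.ofReal_sum_of_nonneg fun s _ => hx s,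
      ENNReal.ofReal_sum_of_nonneg fun s _ => hy s]
    simp only [ENNReal.ofReal_mul (inv_nonneg.2 (hX _).le), ENNReal.ofReal_mul (inv_nonneg.2 (hY _).le)]
  simp only [h1]
  rw [lintegral_add_left (Finset.measurable_fun_sum _ fun s _ => (hg s).const_mul _),
    lintegral_finsetSum _ fun s _ => (hg s).const_mul _,
    lintegral_finsetSum _ fun s _ => (hf s).const_mul _]
  simp only [lintegral_const_mul _ (hg _), lintegral_const_mul _ (hf _)]

theorem sqNorm_of_card_eq_zero (P : Matrix ℕ+ ℕ+ ℝ) {I : Finset ℕ+} (hI : I.card = 0) (v : I → ℝ) :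
    sqNorm P I v = 0 := by
  have : IsEmpty I := by
    rw [Finset.card_eq_zero] at hI
    subst hI
    infer_instance
  simp [sqNorm]

/-- For an empty time set all energies vanish, but division by the cardinality would destroy the
positive bounds; `max _ 1` covers this case and changes nothing otherwise. -/
theorem le_ofReal_card_mul_div {I : Finset ℕ+} {e : ℝ≥0∞} {c : ℝ} (h0 : I.card = 0 → e = 0)
    (he : e ≤ ENNReal.ofReal c) : e ≤ ENNReal.ofReal (I.card * (c / max (I.card : ℝ) 1)) := by
  rcases Nat.eq_zero_or_pos I.card with h | h
  · rw [h0 h]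
    exact zero_le
  · have h1 : (1 : ℝ) ≤ I.card := by exact_mod_cast h
    rw [max_eq_left h1, mul_div_cancel₀ _ (by positivity)]
    exact he

theorem card_mul_le {I : Finset ℕ+} {x c : ℝ} (hx : 0 ≤ x) (h : x ≤ c / max (I.card : ℝ) 1) :
    I.card * x ≤ c := by
  rw [le_div_iff₀ (by positivity)] at h
  have : (I.card : ℝ) ≤ max (I.card : ℝ) 1 := le_max_left _ _
  nlinarith

/-- With positive constants, the Gaussian law with balanced gains is the unique solution of the
maximum entropy problem. -/
theorem isMaxEntLaw_iff {μ : ProbabilityMeasure (PathIdx p₁ p₂ m → ℝ)}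
    (hP : P.PosDef) (hR : R.PosDef) (h : IsZeroMeanGaussianLaw (gainKernel P R X Y) μ)
    (Ig If : Finset ℕ+) {c : Label p₁ p₂ m → ℝ} (hc : ∀ a, 0 < c a)
    (hX : IsBalanced (fun hj : Fin p₁ × Fin p₁ => c (.gOuter hj.1 hj.2) / max (Ig.card : ℝ) 1)
      (fun kl : Fin p₂ × Fin p₂ => c (.gInner kl.1 kl.2) / max (Ig.card : ℝ) 1) X)
    (hY : IsBalanced (fun h : Fin p₁ => c (.fOuter h) / max (If.card : ℝ) 1)
      (fun ki : Fin p₂ × Fin m => c (.fInner ki.1 ki.2) / max (If.card : ℝ) 1) Y)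
    (ν : ProbabilityMeasure (FinIdx p₁ p₂ m Ig If → ℝ)) :
    IsMaxEntLaw P R Ig If c ν ↔ ν = marginal μ Ig If := by
  have hXpos : ∀ s, 0 < X s := fun s => hX.pos (a := s.1) (b := s.2)
    (div_pos (hc _) (by positivity)) (div_pos (hc _) (by positivity))
  have hYpos : ∀ s, 0 < Y s := fun s => hY.pos (a := s.1) (b := s.2)
    (div_pos (hc _) (by positivity)) (div_pos (hc _) (by positivity))
  obtain ⟨κ, hp, hκ⟩ := exists_marginal_density hP hR hXpos hYpos h Ig If
  obtain ⟨hEg, hEf⟩ := gaussian_energies (Ig := Ig) (If := If) hP hR h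
  set p := fun x : FinIdx p₁ p₂ m Ig If → ℝ => Real.exp (-κ - quadForm P R Ig If X Y x / 2) with hpdef
  rw [hκ] at hEg hEf
  -- This is the number of coordinates of the extracted vector.
  set N : ℝ := Ig.card * Fintype.card (GBlock p₁ p₂) + If.card * Fintype.card (FBlock p₁ p₂ m) with hN
  have hN0 : 0 ≤ N := by positivity
  have hQ := measurable_quadForm (P := P) (R := R) (Ig := Ig) (If := If) (X := X) (Y := Y)
  have hQ0 := quadForm_nonneg (Ig := Ig) (If := If) hP hR hXpos hYpos
  -- the energy bound for admissible densities
  have hbound : ∀ q, IsFeasible P R Ig If c q →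
      ∫⁻ x, ENNReal.ofReal (quadForm P R Ig If X Y x) ∂(densityLaw q) ≤ ENNReal.ofReal N := by
    intro q hq
    have hg0 : Ig.card = 0 → ∀ s, gEnergy P Ig If q s = 0 := fun h0 s => by
      simp [gEnergy, sqNorm_of_card_eq_zero P h0]
    have hf0 : If.card = 0 → ∀ s, fEnergy R Ig If q s = 0 := fun h0 s => by
      simp [fEnergy, sqNorm_of_card_eq_zero R h0]
    rw [lintegral_quadForm hP hR hXpos hYpos, hN,
      ENNReal.ofReal_add (by positivity) (by positivity)]
    refine add_le_add ?_ ?_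
    · refine hX.sum_ofReal_inv_mul_le (fun a => div_pos (hc _) (by positivity))
        (fun b => div_pos (hc _) (by positivity)) Ig.card (gEnergy P Ig If q) (fun a => ?_) fun b => ?_
      · refine le_ofReal_card_mul_div (fun h0 => by simp [hg0 h0]) ?_
        have := hq.constraints (.gOuter a.1 a.2)
        rwa [moment, ← Fintype.sum_prod_type'
          (f := fun k l => gEnergy P Ig If q ((a.1, a.2), (k, l)))] at this
      · refine le_ofReal_card_mul_div (fun h0 => by simp [hg0 h0]) ?_
        have := hq.constraints (.gInner b.1 b.2)
        rwa [moment, ← Fintype.sum_prod_type'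
          (f := fun h j => gEnergy P Ig If q ((h, j), (b.1, b.2)))] at this
    · refine hY.sum_ofReal_inv_mul_le (fun a => div_pos (hc _) (by positivity))
        (fun b => div_pos (hc _) (by positivity)) If.card (fEnergy R Ig If q) (fun a => ?_) fun b => ?_
      · refine le_ofReal_card_mul_div (fun h0 => by simp [hf0 h0]) ?_
        have := hq.constraints (.fOuter a)
        rwa [moment, ← Fintype.sum_prod_type'
          (f := fun k i => fEnergy R Ig If q (a, (k, i)))] at this
      · refine le_ofReal_card_mul_div (fun h0 => by simp [hf0 h0]) ?_
        exact hq.constraints (.fInner b.1 b.2)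
  -- the energy of the optimal density
  have henergy : ∫⁻ x, ENNReal.ofReal (quadForm P R Ig If X Y x) ∂(densityLaw p) =
      ENNReal.ofReal N := by
    rw [lintegral_quadForm hP hR hXpos hYpos, hN,
      ENNReal.ofReal_add (by positivity) (by positivity)]
    have hterm : ∀ (n : ℕ) (x : ℝ), 0 < x →
        ENNReal.ofReal x⁻¹ * ENNReal.ofReal (n * x) = ENNReal.ofReal n := fun n x hx => by
      rw [← ENNReal.ofReal_mul (inv_nonneg.2 hx.le)]
      congr 1
      field_simp
    simp only [hEg, hEf, hterm _ _ (hXpos _), hterm _ _ (hYpos _), Finset.sum_const, nsmul_eq_mul,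
      Finset.card_univ]
    rw [mul_comm (Ig.card : ℝ), mul_comm (If.card : ℝ), ENNReal.ofReal_mul (by positivity),
      ENNReal.ofReal_mul (by positivity), ENNReal.ofReal_natCast (Fintype.card (GBlock p₁ p₂)),
      ENNReal.ofReal_natCast (Fintype.card (FBlock p₁ p₂ m))]
  have hmax := entropy_exp_eq hQ hQ0 hp hN0 henergy
  have hgibbs := fun q (hq : IsFeasible P R Ig If c q) =>
    entropy_le_of_lintegral_le hQ hQ0 hp hN0 hq.density (hbound q hq)
  have hfeas : IsFeasible P R Ig If c p := by
    refine ⟨hp, ?_⟩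
    have hg : ∀ s, gEnergy P Ig If p s = ENNReal.ofReal (Ig.card * X s) := hEg
    have hf : ∀ s, fEnergy R Ig If p s = ENNReal.ofReal (If.card * Y s) := hEf
    have hgX : ∀ s, 0 ≤ (Ig.card : ℝ) * X s := fun s => mul_nonneg (Nat.cast_nonneg _) (hXpos s).le
    have hfY : ∀ s, 0 ≤ (If.card : ℝ) * Y s := fun s => mul_nonneg (Nat.cast_nonneg _) (hYpos s).le
    rintro (⟨h, j⟩ | ⟨k, l⟩ | h | ⟨k, i⟩)
    · rw [moment, ← Fintype.sum_prod_type' (f := fun k l => gEnergy P Ig If p ((h, j), (k, l)))]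
      simp only [hg]
      rw [← ENNReal.ofReal_sum_of_nonneg fun _ _ => hgX _, ← Finset.mul_sum]
      exact ENNReal.ofReal_le_ofReal (card_mul_le (Finset.sum_nonneg fun _ _ => (hXpos _).le)
        (hX.row_le (h, j)))
    · rw [moment, ← Fintype.sum_prod_type' (f := fun h j => gEnergy P Ig If p ((h, j), (k, l)))]
      simp only [hg]
      rw [← ENNReal.ofReal_sum_of_nonneg fun _ _ => hgX _, ← Finset.mul_sum]
      exact ENNReal.ofReal_le_ofReal (card_mul_le (Finset.sum_nonneg fun _ _ => (hXpos _).le)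
        (hX.col_le (k, l)))
    · rw [moment, ← Fintype.sum_prod_type' (f := fun k i => fEnergy R Ig If p (h, (k, i)))]
      simp only [hf]
      rw [← ENNReal.ofReal_sum_of_nonneg fun _ _ => hfY _, ← Finset.mul_sum]
      exact ENNReal.ofReal_le_ofReal (card_mul_le (Finset.sum_nonneg fun _ _ => (hYpos _).le)
        (hY.row_le h))
    · rw [moment]
      simp only [hf]
      rw [← ENNReal.ofReal_sum_of_nonneg fun _ _ => hfY _, ← Finset.mul_sum]
      exact ENNReal.ofReal_le_ofReal (card_mul_le (Finset.sum_nonneg fun _ _ => (hYpos _).le)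
        (hY.col_le (k, i)))
  constructor
  · rintro ⟨q, hq, hqmax, hν⟩
    refine Subtype.ext ?_
    change (ν : Measure (FinIdx p₁ p₂ m Ig If → ℝ)) = marginal μ Ig If
    rw [hν, hκ]
    -- An optimal `q` has at least the entropy of `p`, which is the Gibbs bound, so the equality
    -- case identifies its law.
    exact (hgibbs q hq).2 (hmax ▸ hqmax p hfeas)
  · rintro rfl
    exact ⟨p, hfeas, fun q hq => hmax ▸ (hgibbs q hq).1, hκ⟩

end MaxEnt

/-! ### Extended maximum entropy processes -/

section MaxEntProcess

variable {p₁ p₂ m : ℕ} {P R : Matrix ℕ+ ℕ+ ℝ} {X : GBlock p₁ p₂ → ℝ} {Y : FBlock p₁ p₂ m → ℝ}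

/-- It makes the neighbourhood filters in the space of constants countably generated, as dominated
convergence along them requires. -/
instance : Countable (Label p₁ p₂ m) := by
  let f : Label p₁ p₂ m → (Fin p₁ × Fin p₁ ⊕ Fin p₂ × Fin p₂) ⊕ (Fin p₁ ⊕ Fin p₂ × Fin m)
    | .gOuter h j => .inl (.inl (h, j))
    | .gInner k l => .inl (.inr (k, l))
    | .fOuter h => .inr (.inl h)
    | .fInner k i => .inr (.inr (k, i))
  refine Function.Injective.countable (f := f) ?_
  rintro (⟨h, j⟩ | ⟨k, l⟩ | h | ⟨k, i⟩) (⟨h', j'⟩ | ⟨k', l'⟩ | h' | ⟨k', i'⟩) heq <;>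
    simp_all [f]

/-- The rows and columns of `X` and `Y` are balanced for the constants `c` divided by `a` on the
labels of `g` and by `b` on the labels of `f`. -/
structure IsGains (a b : ℝ) (c : Label p₁ p₂ m → ℝ) (X : GBlock p₁ p₂ → ℝ)
    (Y : FBlock p₁ p₂ m → ℝ) : Prop where
  balanced_g : IsBalanced (fun hj : Fin p₁ × Fin p₁ => c (.gOuter hj.1 hj.2) / a)
    (fun kl : Fin p₂ × Fin p₂ => c (.gInner kl.1 kl.2) / a) X
  balanced_f : IsBalanced (fun h : Fin p₁ => c (.fOuter h) / b)
    (fun ki : Fin p₂ × Fin m => c (.fInner ki.1 ki.2) / b) Y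

theorem exists_isGains {a b : ℝ} (ha : 0 < a) (hb : 0 < b) {c : Label p₁ p₂ m → ℝ}
    (hc : ∀ a, 0 ≤ c a) (hc' : NonNull c) : ∃ X Y, IsGains a b c X Y := by
  obtain ⟨⟨h, j, h1⟩, ⟨k, l, h2⟩, ⟨h', h3⟩, ⟨k', i, h4⟩⟩ := hc'
  obtain ⟨X, hX⟩ := exists_isBalanced (fun hj : Fin p₁ × Fin p₁ => c (.gOuter hj.1 hj.2) / a)
    (fun kl : Fin p₂ × Fin p₂ => c (.gInner kl.1 kl.2) / a) (fun _ => div_nonneg (hc _) ha.le)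
    (fun _ => div_nonneg (hc _) ha.le) ⟨(h, j), div_pos h1 ha⟩ ⟨(k, l), div_pos h2 ha⟩
  obtain ⟨Y, hY⟩ := exists_isBalanced (fun h : Fin p₁ => c (.fOuter h) / b)
    (fun ki : Fin p₂ × Fin m => c (.fInner ki.1 ki.2) / b) (fun _ => div_nonneg (hc _) hb.le)
    (fun _ => div_nonneg (hc _) hb.le) ⟨h', div_pos h3 hb⟩ ⟨(k', i), div_pos h4 hb⟩
  exact ⟨X, Y, hX, hY⟩

/-- Only the labels supplied by `NonNull c` matter: they show that none of the four families is
empty. -/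
theorem NonNull.of_pos {c c' : Label p₁ p₂ m → ℝ} (hc : NonNull c) (hc' : ∀ a, 0 < c' a) :
    NonNull c' := by
  obtain ⟨⟨h, j, -⟩, ⟨k, l, -⟩, ⟨h', -⟩, ⟨k', i, -⟩⟩ := hc
  exact ⟨⟨h, j, hc' _⟩, ⟨k, l, hc' _⟩, ⟨h', hc' _⟩, ⟨k', i, hc' _⟩⟩

/-- The Gaussian process with gains balanced for `c` is an extended maximum entropy process. -/
theorem isMaxEntProcess_of_isGains (hP : P.PosDef) (hR : R.PosDef) {c : Label p₁ p₂ m → ℝ}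
    (hc : ∀ a, 0 ≤ c a) (hc' : NonNull c) (hX : IsGains 1 1 c X Y)
    {μ : ProbabilityMeasure (PathIdx p₁ p₂ m → ℝ)}
    (hμ : IsZeroMeanGaussianLaw (Matrix.fromBlocks
      ((1 : Matrix (GBlock p₁ p₂) (GBlock p₁ p₂) ℝ) ⊗ₖ P) 0 0
        ((1 : Matrix (FBlock p₁ p₂ m) (FBlock p₁ p₂ m) ℝ) ⊗ₖ R)) μ) :
    IsMaxEntProcess P R c (scaleLaw (gainScale X Y) μ) := by
  intro Ig If
  have hg : (0 : ℝ) < max (Ig.card : ℝ) 1 := by positivity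
  have hf : (0 : ℝ) < max (If.card : ℝ) 1 := by positivity
  -- The gains are chosen for all `C` at once; the value `0` away from positive constants is never
  -- looked at.
  have hex : ∀ C : Label p₁ p₂ m → ℝ, ∃ Z : (GBlock p₁ p₂ → ℝ) × (FBlock p₁ p₂ m → ℝ),
      (∀ a, 0 < C a) → IsGains (max (Ig.card : ℝ) 1) (max (If.card : ℝ) 1) C Z.1 Z.2 := by
    intro C
    by_cases hC : ∀ a, 0 < C a
    · obtain ⟨X', Y', h⟩ := exists_isGains hg hf (fun a => (hC a).le) (hc'.of_pos hC)
      exact ⟨(X', Y'), fun _ => h⟩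
    · exact ⟨0, fun h => absurd h hC⟩
  choose Z hZ using hex
  refine ⟨fun C => marginal (scaleLaw (gainScale (Z C).1 (Z C).2) μ) Ig If, fun C hC ν => ?_, ?_⟩
  · have hZC := hZ C hC
    have hX0 : ∀ s, 0 ≤ (Z C).1 s := hZC.balanced_g.nonneg
    have hY0 : ∀ s, 0 ≤ (Z C).2 s := hZC.balanced_f.nonneg
    exact isMaxEntLaw_iff hP hR (hμ.scaleLaw _ (gainKernel_eq_scale hX0 hY0)) Ig If hC
      hZC.balanced_g hZC.balanced_f ν
  · have hpos : ∀ᶠ C in 𝓝[{C | ∀ a, 0 < C a}] (scaledConstants Ig If c), ∀ a, 0 < C a :=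
      self_mem_nhdsWithin
    have hlim : ∀ (a : Label p₁ p₂ m) (n : ℝ), Tendsto (fun C : Label p₁ p₂ m → ℝ => C a / n)
        (𝓝[{C | ∀ a, 0 < C a}] (scaledConstants Ig If c))
        (𝓝 (scaledConstants Ig If c a / n)) := fun a n =>
      (((continuous_apply (A := fun _ => ℝ) a).tendsto (scaledConstants Ig If c)).mono_left
        nhdsWithin_le_nhds).div_const n
    -- Any coordinate of the extracted vector supplies an element of `I`, so here the maximum is
    -- `|I|` and cancels the scaling: the limiting program does not depend on the time set.
    have hcancel : ∀ (I : Finset ℕ+) (_ : I) (x : ℝ), (I.card : ℝ) * x / max (I.card : ℝ) 1 = x / 1 := by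
      intro I t x
      have h1 : (1 : ℝ) ≤ I.card := by
        exact_mod_cast Nat.succ_le_of_lt (Finset.card_pos.2 (⟨t.1, t.2⟩ : I.Nonempty))
      rw [max_eq_left h1, mul_div_cancel_left₀ _ (by positivity), div_one]
    refine tendsto_marginal_scaleLaw μ Ig If ?_
    rintro (⟨s, t⟩ | ⟨s, t⟩)
    · refine (Real.continuous_sqrt.tendsto _).comp (hX.balanced_g.tendsto
        (r' := fun C hj => C (.gOuter hj.1 hj.2) / max (Ig.card : ℝ) 1)
        (c' := fun C kl => C (.gInner kl.1 kl.2) / max (Ig.card : ℝ) 1)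
        (fun a => div_nonneg (hc _) zero_le_one) (fun b => div_nonneg (hc _) zero_le_one)
        (fun a => ?_) (fun b => ?_) (hpos.mono fun C hC a => div_pos (hC _) hg)
        (hpos.mono fun C hC b => div_pos (hC _) hg) (hpos.mono fun C hC => (hZ C hC).balanced_g) s)
      · exact hcancel Ig t (c (.gOuter a.1 a.2)) ▸ hlim (.gOuter a.1 a.2) _
      · exact hcancel Ig t (c (.gInner b.1 b.2)) ▸ hlim (.gInner b.1 b.2) _
    · refine (Real.continuous_sqrt.tendsto _).comp (hX.balanced_f.tendsto
        (r' := fun C h => C (.fOuter h) / max (If.card : ℝ) 1)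
        (c' := fun C ki => C (.fInner ki.1 ki.2) / max (If.card : ℝ) 1)
        (fun a => div_nonneg (hc _) zero_le_one) (fun b => div_nonneg (hc _) zero_le_one)
        (fun a => ?_) (fun b => ?_) (hpos.mono fun C hC a => div_pos (hC _) hf)
        (hpos.mono fun C hC b => div_pos (hC _) hf) (hpos.mono fun C hC => (hZ C hC).balanced_f) s)
      · exact hcancel If t (c (.fOuter a)) ▸ hlim (.fOuter a) _
      · exact hcancel If t (c (.fInner b.1 b.2)) ▸ hlim (.fInner b.1 b.2) _

/-- A process whose gains are those of the hyperparameters `ξ` and are balanced for `c`. -/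
theorem exists_isMaxEntProcess (hP : P.PosDef) (hR : R.PosDef) {c ξ : Label p₁ p₂ m → ℝ}
    (hc : ∀ a, 0 ≤ c a) (hc' : NonNull c)
    (h : IsGains 1 1 c
      (fun s => ξ (.gOuter s.1.1 s.1.2) * ξ (.gInner s.2.1 s.2.2) /
        (ξ (.gOuter s.1.1 s.1.2) + ξ (.gInner s.2.1 s.2.2)))
      (fun s => ξ (.fOuter s.1) * ξ (.fInner s.2.1 s.2.2) /
        (ξ (.fOuter s.1) + ξ (.fInner s.2.1 s.2.2)))) :
    ∃ μ : ProbabilityMeasure (PathIdx p₁ p₂ m → ℝ),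
      IsZeroMeanGaussianLaw (jointKernel P R ξ) μ ∧ IsMaxEntProcess P R c μ := by
  obtain ⟨μ, hμ⟩ := exists_unit_process (p₁ := p₁) (p₂ := p₂) (m := m) hP hR
  exact ⟨_, hμ.scaleLaw _ (gainKernel_eq_scale h.balanced_g.nonneg h.balanced_f.nonneg),
    isMaxEntProcess_of_isGains hP hR hc hc' h hμ⟩

/-! ### Passage between hyperparameters and constants -/

/-- Constants for given hyperparameters. -/
theorem exists_constants {ξ : Label p₁ p₂ m → ℝ} (hξ : ∀ a, 0 ≤ ξ a) (hξ' : NonNull ξ) :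
    ∃ c : Label p₁ p₂ m → ℝ, (∀ a, 0 ≤ c a) ∧ (∀ a, 0 < c a ↔ 0 < ξ a) ∧ IsGains 1 1 c
      (fun s => ξ (.gOuter s.1.1 s.1.2) * ξ (.gInner s.2.1 s.2.2) /
        (ξ (.gOuter s.1.1 s.1.2) + ξ (.gInner s.2.1 s.2.2)))
      (fun s => ξ (.fOuter s.1) * ξ (.fInner s.2.1 s.2.2) /
        (ξ (.fOuter s.1) + ξ (.fInner s.2.1 s.2.2))) := by
  obtain ⟨⟨h, j, h1⟩, ⟨k, l, h2⟩, ⟨h', h3⟩, ⟨k', i, h4⟩⟩ := hξ'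
  obtain ⟨rg, cg, hrg, hcg, hrg', hcg', hg⟩ := exists_isBalanced_div
    (fun hj : Fin p₁ × Fin p₁ => ξ (.gOuter hj.1 hj.2))
    (fun kl : Fin p₂ × Fin p₂ => ξ (.gInner kl.1 kl.2)) (fun _ => hξ _) (fun _ => hξ _)
    ⟨(h, j), h1⟩ ⟨(k, l), h2⟩
  obtain ⟨rf, cf, hrf, hcf, hrf', hcf', hf⟩ := exists_isBalanced_div
    (fun h : Fin p₁ => ξ (.fOuter h)) (fun ki : Fin p₂ × Fin m => ξ (.fInner ki.1 ki.2))
    (fun _ => hξ _) (fun _ => hξ _) ⟨h', h3⟩ ⟨(k', i), h4⟩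
  refine ⟨Label.rec (fun h j => rg (h, j)) (fun k l => cg (k, l)) rf fun k i => cf (k, i),
    ?_, ?_, ?_, ?_⟩
  · rintro (⟨h, j⟩ | ⟨k, l⟩ | h | ⟨k, i⟩)
    exacts [hrg _, hcg _, hrf _, hcf _]
  · rintro (⟨h, j⟩ | ⟨k, l⟩ | h | ⟨k, i⟩)
    exacts [hrg' _, hcg' _, hrf' _, hcf' _]
  · simpa only [div_one] using hg
  · simpa only [div_one] using hf

/-- Hyperparameters for given constants. -/
theorem exists_hyperparameters {c : Label p₁ p₂ m → ℝ} (hc : ∀ a, 0 ≤ c a) (hc' : NonNull c) :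
    ∃ ξ : Label p₁ p₂ m → ℝ, (∀ a, 0 ≤ ξ a) ∧ (∀ a, 0 < ξ a ↔ 0 < c a) ∧ IsGains 1 1 c
      (fun s => ξ (.gOuter s.1.1 s.1.2) * ξ (.gInner s.2.1 s.2.2) /
        (ξ (.gOuter s.1.1 s.1.2) + ξ (.gInner s.2.1 s.2.2)))
      (fun s => ξ (.fOuter s.1) * ξ (.fInner s.2.1 s.2.2) /
        (ξ (.fOuter s.1) + ξ (.fInner s.2.1 s.2.2))) := by
  obtain ⟨X, Y, hX, hY⟩ := exists_isGains one_pos one_pos hc hc'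
  obtain ⟨⟨h, j, h1⟩, ⟨k, l, h2⟩, ⟨h', h3⟩, ⟨k', i, h4⟩⟩ := hc'
  simp only [div_one] at hX hY
  obtain ⟨lg, γg, hlg, hγg, hlg', hγg', hg⟩ := hX.exists_eq_div ⟨(h, j), h1⟩ ⟨(k, l), h2⟩
  obtain ⟨lf, γf, hlf, hγf, hlf', hγf', hf⟩ := hY.exists_eq_div ⟨h', h3⟩ ⟨(k', i), h4⟩
  refine ⟨Label.rec (fun h j => lg (h, j)) (fun k l => γg (k, l)) lf fun k i => γf (k, i),
    ?_, ?_, ?_, ?_⟩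
  · rintro (⟨h, j⟩ | ⟨k, l⟩ | h | ⟨k, i⟩)
    exacts [hlg _, hγg _, hlf _, hγf _]
  · rintro (⟨h, j⟩ | ⟨k, l⟩ | h | ⟨k, i⟩)
    exacts [hlg' _, hγg' _, hlf' _, hγf' _]
  · have : X = fun s : GBlock p₁ p₂ => lg s.1 * γg s.2 / (lg s.1 + γg s.2) := funext fun s => hg _ _
    rw [this] at hX
    simpa only [div_one] using hX
  · have : Y = fun s : FBlock p₁ p₂ m => lf s.1 * γf s.2 / (lf s.1 + γf s.2) := funext fun s => hf _ _
    rw [this] at hY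
    simpa only [div_one] using hY

end MaxEntProcess

end KroneckerMaxEnt

theorem mainTheorem4 {p₁ p₂ m : ℕ} (P R : Matrix ℕ+ ℕ+ ℝ)
    (hP : KroneckerMaxEnt.IsAdmissibleKernel P) (hR : KroneckerMaxEnt.IsAdmissibleKernel R) :
    (∀ ξ : KroneckerMaxEnt.Label p₁ p₂ m → ℝ, (∀ a, 0 ≤ ξ a) → KroneckerMaxEnt.NonNull ξ →
      ∃ μ : ProbabilityMeasure (KroneckerMaxEnt.PathIdx p₁ p₂ m → ℝ),
        KroneckerMaxEnt.IsZeroMeanGaussianLaw (KroneckerMaxEnt.jointKernel P R ξ) μ ∧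
        ∃ c : KroneckerMaxEnt.Label p₁ p₂ m → ℝ, (∀ a, 0 ≤ c a) ∧ (∀ a, 0 < c a ↔ 0 < ξ a) ∧
          KroneckerMaxEnt.IsMaxEntProcess P R c μ) ∧
    (∀ c : KroneckerMaxEnt.Label p₁ p₂ m → ℝ, (∀ a, 0 ≤ c a) → KroneckerMaxEnt.NonNull c →
      ∃ ξ : KroneckerMaxEnt.Label p₁ p₂ m → ℝ, (∀ a, 0 ≤ ξ a) ∧ (∀ a, 0 < ξ a ↔ 0 < c a) ∧
        ∃ μ : ProbabilityMeasure (KroneckerMaxEnt.PathIdx p₁ p₂ m → ℝ),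
          KroneckerMaxEnt.IsZeroMeanGaussianLaw (KroneckerMaxEnt.jointKernel P R ξ) μ ∧
          KroneckerMaxEnt.IsMaxEntProcess P R c μ) := by
  refine ⟨fun ξ hξ hξ' => ?_, fun c hc hc' => ?_⟩
  · obtain ⟨c, hc, hpos, hgains⟩ := KroneckerMaxEnt.exists_constants hξ hξ'
    have hc' : KroneckerMaxEnt.NonNull c := by
      simpa only [KroneckerMaxEnt.NonNull, hpos] using hξ'
    obtain ⟨μ, hμ, hmax⟩ :=
      KroneckerMaxEnt.exists_isMaxEntProcess hP.posDef hR.posDef hc hc' hgains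
    exact ⟨μ, hμ, c, hc, hpos, hmax⟩
  · obtain ⟨ξ, hξ, hpos, hgains⟩ := KroneckerMaxEnt.exists_hyperparameters hc hc'
    exact ⟨ξ, hξ, hpos,
      KroneckerMaxEnt.exists_isMaxEntProcess hP.posDef hR.posDef hc hc' hgains⟩
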